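/- **Conventions.** Graphs are finite, simple and nonempty; a graph property $\mathcal P$ is an isomorphism-invariant class of graphs. It is *edge-monotone* if removing edges from a graph in $\mathcal P$ yields a graph in $\mathcal P$. A *witness* against $G\in\mathcal P$ is a nonempty induced subgraph $G'$ of $G$ such that no graph containing (a copy of) $G'$ as an induced subgraph has $\mathcal P$. The property $\mathcal P$ is *non-disjointed* if every graph without $\mathcal P$ contains a witness, and every witness $G'$ against $G\in\mathcal P$ has a connected induced subgraph $G''$ that is also a witness against $G\in\mathcal P$. A graph $G=(V,E)$ is *$\varepsilon$-far* from $\mathcal P$ if $G\notin\mathcal P$ and $|E\,\triangle\,E(H)|\ge\varepsilon|E|$ for every graph $H\in\mathcal P$ on the vertex set $V$. In the (randomized) CONGEST model the $n$ vertices of the network $G$ are processors with distinct IDs in $\{0,\dots,n^{\kappa}-1\}$, where $\kappa\ge 1$ is a fixed integer. Every processor knows $n$, its own ID and the IDs of its neighbours, and has a finite number (depending on $n$ and the algorithm) of private independent fair coin tosses. In each synchronous round every processor performs an arbitrary local computation and sends a (possibly empty) message of at most $B\lceil\log_2 n\rceil$ bits to each of its neighbours, where $B$ is a constant. A processor eventually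 stops and outputs ACCEPT or REJECT; the number of rounds is counted until all processors have stopped. $\mathcal P$ *can be verified in $O(\mathrm{diam}(G))$ rounds* if there are a CONGEST algorithm and a constant $c$ such that on every connected network $G$, for all ID assignments and all outcomes of the coin tosses (a deterministic algorithm uses none), all processors stop within $c\,(\mathrm{diam}(G)+1)$ rounds, and all of them accept if and only if $G\in\mathcal P$. A *one-sided $\varepsilon$-tester* for $\mathcal P$ is a randomized CONGEST algorithm such that on every network $G$ (connected or not), for every ID assignment: if $G\in\mathcal P$, then all processors accept, whatever the coin tosses; if $G$ is $\varepsilon$-far from $\mathcal P$, then with probability at least $2/3$ at least one processor rejects. **Theorem.** Let $\mathcal P$ be an edge-monotone, non-disjointed graph property that can be verified in the CONGEST model in $O(\mathrm{diam}(G))$ rounds. Then there are constants $C$ and $B$, depending only on $\mathcal P$ and $\kappa$, such that for every $\varepsilon>0$ there is a one-sided $\varepsilon$-tester for $\mathcal P$ in the randomized CONGEST model which uses messages of at most $B\lceil\log_2 n\rceil$ bits and in which all processors stop, on every network with $n$ processors and for all outcomes of the coin tosses, within $C\,(\log n)/\varepsilon$ rounds. -/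

import Mathlib

/-- A property of finite simple graphs, invariant under isomorphism. -/
structure GraphProperty where
  Holds : ∀ {V : Type} [Finite V], SimpleGraph V → Prop
  iso_invariant : ∀ {V W : Type} [Finite V] [Finite W] {G : SimpleGraph V} {H : SimpleGraph W},
    Nonempty (G ≃g H) → Holds G → Holds H

namespace GraphProperty

/-- Removing edges preserves the property. -/
def EdgeMonotone (P : GraphProperty) : Prop :=
  ∀ (V : Type) [Finite V] (G G' : SimpleGraph V), G' ≤ G → P.Holds G → P.Holds G'

/-- `W` is a witness against `P`: its presence as an induced subgraph certifies that a graph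
does not have `P`. -/
def IsWitness (P : GraphProperty) {U : Type} (W : SimpleGraph U) : Prop :=
  ∀ (V : Type) [Finite V] (H : SimpleGraph V), W.IsIndContained H → ¬ P.Holds H

/-- `P` is non-disjointed: inside every witness against `G ∈ P` there is a connected induced
subgraph that is again a witness. It is understood here that the failure of `P` is always
certified by a witness; this is the first field. Witnesses against `G ∈ P` are (nonempty)
induced subgraphs of `G`, given by their vertex sets. -/
structure NonDisjointed (P : GraphProperty) : Prop where
  exists_witness : ∀ (V : Type) [Finite V] [Nonempty V] (G : SimpleGraph V), ¬ P.Holds G →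
    ∃ U : Set V, U.Nonempty ∧ P.IsWitness (G.induce U)
  connected_witness : ∀ (V : Type) [Finite V] (G : SimpleGraph V) (U : Set V), U.Nonempty →
    P.IsWitness (G.induce U) →
    ∃ U' ⊆ U, (G.induce U').Connected ∧ P.IsWitness (G.induce U')

/-- `G` is `ε`-far from `P` in the general graph model: `G` does not have `P`, and at least
`ε |E(G)|` edges must be added or removed in order to obtain `P`. -/
def IsFar (P : GraphProperty) (ε : ℝ) {V : Type} [Finite V] (G : SimpleGraph V) : Prop :=
  ¬ P.Holds G ∧ ∀ H : SimpleGraph V, P.Holds H →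
    ε * (G.edgeSet.ncard : ℝ) ≤ ((symmDiff G.edgeSet H.edgeSet).ncard : ℝ)

end GraphProperty

/-- A synchronous message-passing algorithm for accepting or rejecting the network. Every
processor is given the number `n` of processors, its own ID, the IDs of its neighbours and
`coins n` private bits. Messages are natural numbers, read as bit strings through their binary
expansion; `0` is the empty message. A processor with `output s = some b` has stopped, with
verdict accept (`b = true`) or reject (`b = false`). -/
structure DistAlgorithm where
  State : Type
  coins : ℕ → ℕ
  init : (n : ℕ) → (ownId : ℕ) → (nbrIds : Finset ℕ) → (Fin (coins n) → Bool) → State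
  /-- The message that a processor sends to its neighbour with the given ID. -/
  send : State → (nbrId : ℕ) → ℕ
  /-- The update at the end of a round, from the messages received, indexed by sender ID. -/
  step : State → (inbox : ℕ → ℕ) → State
  output : State → Option Bool

/-- The processors have distinct IDs of `O(log n)` bits, namely from `{0, …, n ^ κ - 1}`. -/
def IsIdAssignment (κ : ℕ) {V : Type} [Fintype V] (ident : V → ℕ) : Prop :=
  Function.Injective ident ∧ ∀ v, ident v < Fintype.card V ^ κ

namespace DistAlgorithm

noncomputable section

/-- The message from a processor in state `s`; a processor that has stopped sends only empty
messages. -/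
def message (A : DistAlgorithm) (s : A.State) (nbrId : ℕ) : ℕ :=
  if (A.output s).isSome then 0 else A.send s nbrId

/-- Outcomes of all private coin tosses in a network with processor set `V`. -/
abbrev Coins (A : DistAlgorithm) (V : Type) [Fintype V] : Type :=
  V → Fin (A.coins (Fintype.card V)) → Bool

open Classical in
/-- The state of every processor after `t` rounds, for given outcomes `ω` of the coin tosses.
A processor that has stopped keeps its state. -/
def stateAt (A : DistAlgorithm) {V : Type} [Fintype V] (G : SimpleGraph V) (ident : V → ℕ)
    (ω : A.Coins V) : ℕ → V → A.State
  | 0, v => A.init (Fintype.card V) (ident v) ((G.neighborFinset v).image ident) (ω v)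
  | t + 1, v =>
    if (A.output (A.stateAt G ident ω t v)).isSome then A.stateAt G ident ω t v
    else A.step (A.stateAt G ident ω t v)
      (Function.extend (fun u : G.neighborSet v => ident u)
        (fun u => A.message (A.stateAt G ident ω t u) (ident v)) (fun _ => 0))

/-- The verdict of `v` after `t` rounds; `none` if `v` is still running. -/
def verdict (A : DistAlgorithm) {V : Type} [Fintype V] (G : SimpleGraph V) (ident : V → ℕ)
    (ω : A.Coins V) (t : ℕ) (v : V) : Option Bool :=
  A.output (A.stateAt G ident ω t v)

/-- All messages have at most `B ⌈log₂ n⌉` bits. -/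
def RespectsBandwidth (A : DistAlgorithm) (B : ℕ) {V : Type} [Fintype V] (G : SimpleGraph V)
    (ident : V → ℕ) : Prop :=
  ∀ (ω : A.Coins V) (t : ℕ) (u v : V), G.Adj u v →
    (A.message (A.stateAt G ident ω t u) (ident v)).size ≤ B * Nat.clog 2 (Fintype.card V)

/-- All processors have stopped after at most `T` rounds, whatever the coin tosses. -/
def HaltsWithin (A : DistAlgorithm) (T : ℕ) {V : Type} [Fintype V] (G : SimpleGraph V)
    (ident : V → ℕ) : Prop :=
  ∀ (ω : A.Coins V) (v : V), (A.verdict G ident ω T v).isSome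

/-- The final verdict of `v` is `b`. -/
def Outputs (A : DistAlgorithm) {V : Type} [Fintype V] (G : SimpleGraph V) (ident : V → ℕ)
    (ω : A.Coins V) (v : V) (b : Bool) : Prop :=
  ∃ t, A.verdict G ident ω t v = some b

open Classical in
/-- The probability, over independent fair coins, that at least one processor rejects. -/
def rejectProb (A : DistAlgorithm) {V : Type} [Fintype V] (G : SimpleGraph V)
    (ident : V → ℕ) : ℝ :=
  (Fintype.card {ω : A.Coins V // ∃ v, A.Outputs G ident ω v false} : ℝ) /
    (Fintype.card (A.Coins V) : ℝ)

end

end DistAlgorithm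

/-- `P` can be verified in the CONGEST model (IDs below `n ^ κ`) in `O(diam G)` rounds: on every
connected network all processors stop within `c (diam G + 1)` rounds, and all of them accept if
and only if the network has `P`. The verifier never errs; it is deterministic when it uses
no coins. -/
def VerifiableInDiameterRounds (κ : ℕ) (P : GraphProperty) : Prop :=
  ∃ (A : DistAlgorithm) (B c : ℕ),
    ∀ (V : Type) [Fintype V] (G : SimpleGraph V) (ident : V → ℕ),
      G.Connected → IsIdAssignment κ ident →
        A.RespectsBandwidth B G ident ∧
        A.HaltsWithin (c * (G.diam + 1)) G ident ∧
        ∀ ω : A.Coins V, (∀ v, A.Outputs G ident ω v true) ↔ P.Holds G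

/-- `A` is a one-sided `ε`-tester for `P` in the randomized CONGEST model (IDs below `n ^ κ`),
with messages of at most `B ⌈log₂ n⌉` bits and at most `T n` rounds on networks with `n`
processors. -/
structure IsOneSidedTester (κ : ℕ) (P : GraphProperty) (ε : ℝ) (B : ℕ) (T : ℕ → ℝ)
    (A : DistAlgorithm) : Prop where
  bandwidth : ∀ (V : Type) [Fintype V] (G : SimpleGraph V) (ident : V → ℕ),
    IsIdAssignment κ ident → A.RespectsBandwidth B G ident
  rounds : ∀ (V : Type) [Fintype V] [Nonempty V] (G : SimpleGraph V) (ident : V → ℕ),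
    IsIdAssignment κ ident →
      ∃ t : ℕ, (t : ℝ) ≤ T (Fintype.card V) ∧ A.HaltsWithin t G ident
  complete : ∀ (V : Type) [Fintype V] (G : SimpleGraph V) (ident : V → ℕ),
    IsIdAssignment κ ident → P.Holds G → ∀ (ω : A.Coins V) (v : V), A.Outputs G ident ω v true
  sound : ∀ (V : Type) [Fintype V] [Nonempty V] (G : SimpleGraph V) (ident : V → ℕ),
    IsIdAssignment κ ident → P.IsFar ε G → 2 / 3 ≤ A.rejectProb G ident

/-!
Every vertex `u` delays the start of its own cluster by `K - y u`, where `y u` is a geometric random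
variable of mean about `1 / ε`, and a vertex joins the cluster that reaches it first. A vertex `v`
whose shifted values `y u - dist u v` have a maximum ahead of all others by at least `3` lies in the
same cluster as its neighbours. Adding `3` to the maximal value is injective and changes the
probability of a configuration by the factor `(1 - p) ^ 3`, so such a gap fails with probability
`O(p)`; by Markov's inequality, fewer than an `ε`-fraction of the edges join different clusters with
probability at least `2 / 3`, and removing these edges from a graph that is `ε`-far from the
property leaves a graph without it.

The latter graph has a connected witness, which lies inside one cluster, so that cluster violates
the property, whereas all induced subgraphs of a graph with the property have it. Hence it suffices
to run the verifier in all clusters at once. Clusters have diameter `O(log n / ε)`, but the verifier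
expects IDs that are polynomial in the size of the cluster: these are obtained by numbering the
vertices of the breadth-first tree of each cluster in preorder.
-/

/-! ### Gaps between shifted geometric variables -/

section Gap

open Finset

variable {V : Type*}

/-- The shifted values `y u - D u` have a maximum that beats all others by at least `3`. The
inequalities are written without subtraction of natural numbers. -/
def HasGap (D y : V → ℕ) : Prop :=
  ∃ u, ∀ u', u' ≠ u → y u' + D u + 3 ≤ y u + D u'

variable [Finite V] [Nonempty V]

theorem exists_forall_add_le_add (D y : V → ℕ) : ∃ u, ∀ u', y u' + D u ≤ y u + D u' := by
  obtain ⟨u, hu⟩ := Finite.exists_max fun u => (y u : ℤ) - D u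
  exact ⟨u, fun u' => by have := hu u'; omega⟩

variable [DecidableEq V]

/-- The configuration `y` with a maximal shifted value raised by `3`, which creates a gap. -/
noncomputable def raiseTop (D y : V → ℕ) : V → ℕ :=
  Function.update y (exists_forall_add_le_add D y).choose
    (y (exists_forall_add_le_add D y).choose + 3)

theorem exists_raiseTop_eq_update (D y : V → ℕ) :
    ∃ u, raiseTop D y = Function.update y u (y u + 3) ∧
      ∀ u', u' ≠ u → raiseTop D y u' + D u + 3 ≤ raiseTop D y u + D u' := by
  refine ⟨_, rfl, fun u' hu' => ?_⟩
  have := (exists_forall_add_le_add D y).choose_spec u'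
  simp only [raiseTop, Function.update_self, Function.update_of_ne hu']
  omega

theorem hasGap_raiseTop (D y : V → ℕ) : HasGap D (raiseTop D y) :=
  let ⟨u, _, hgap⟩ := exists_raiseTop_eq_update D y
  ⟨u, hgap⟩

theorem raiseTop_le (D y : V → ℕ) (v : V) : raiseTop D y v ≤ y v + 3 := by
  obtain ⟨u, hu, -⟩ := exists_raiseTop_eq_update D y
  rw [hu, Function.update_apply]
  split_ifs with h
  · rw [h]
  · exact Nat.le_add_right _ _

theorem raiseTop_injective (D : V → ℕ) : Function.Injective (raiseTop D) := by
  intro y y' h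
  obtain ⟨u, hu, hgap⟩ := exists_raiseTop_eq_update D y
  obtain ⟨u', hu', hgap'⟩ := exists_raiseTop_eq_update D y'
  obtain rfl : u = u' := by
    by_contra hne
    have h₁ := hgap u' (Ne.symm hne)
    have h₂ := hgap' u hne
    rw [h] at h₁
    omega
  rw [hu, hu'] at h
  funext v
  have hv := congrFun h v
  by_cases hvu : v = u
  · subst hvu
    simpa only [Function.update_self, Nat.add_right_cancel_iff] using hv
  · simpa only [Function.update_of_ne hvu] using hv

end Gap

section GapWeight

open Finset

variable {V : Type*} [Fintype V] [Nonempty V] [DecidableEq V]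

theorem prod_raiseTop (D y : V → ℕ) {w : ℕ → ℝ} {r : ℝ} (hr : ∀ j, w (j + 3) = r * w j) :
    ∏ u, w (raiseTop D y u) = r * ∏ u, w (y u) := by
  obtain ⟨u, hu, -⟩ := exists_raiseTop_eq_update D y
  rw [hu, ← mul_prod_erase univ _ (mem_univ u),
    ← mul_prod_erase univ (fun u => w (y u)) (mem_univ u), Function.update_self, hr, mul_assoc]
  congr 2
  exact prod_congr rfl fun v hv => by rw [Function.update_of_ne (ne_of_mem_erase hv)]

open Classical in
theorem mul_pow_le_sum_hasGap (D : V → ℕ) {w : ℕ → ℝ} {r : ℝ} (hw : ∀ j, 0 ≤ w j)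
    (hr : ∀ j, w (j + 3) = r * w j) (M : ℕ) :
    r * (∑ j ∈ range M, w j) ^ Fintype.card V ≤
      ∑ y ∈ Fintype.piFinset fun _ : V => range (M + 3) with HasGap D y, ∏ u, w (y u) := by
  calc r * (∑ j ∈ range M, w j) ^ Fintype.card V
      = ∑ y ∈ Fintype.piFinset fun _ : V => range M, ∏ u, w (raiseTop D y u) := by
        simp only [prod_raiseTop D _ hr, ← mul_sum, ← prod_univ_sum, prod_const, card_univ]
    _ = ∑ y ∈ (Fintype.piFinset fun _ : V => range M).image (raiseTop D), ∏ u, w (y u) :=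
        (sum_image (f := fun y => ∏ u, w (y u))
          fun _ _ _ _ h => raiseTop_injective D h).symm
    _ ≤ _ := by
        refine sum_le_sum_of_subset_of_nonneg ?_ fun y _ _ => prod_nonneg fun u _ => hw _
        intro z hz
        obtain ⟨y, hy, rfl⟩ := mem_image.1 hz
        refine mem_filter.2 ⟨Fintype.mem_piFinset.2 fun v => mem_range.2 ?_, hasGap_raiseTop D y⟩
        have := mem_range.1 (Fintype.mem_piFinset.1 hy v)
        have := raiseTop_le D y v
        omega

open Classical in
theorem sum_not_hasGap_le (D : V → ℕ) {w : ℕ → ℝ} {r : ℝ} (hw : ∀ j, 0 ≤ w j)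
    (hr : ∀ j, w (j + 3) = r * w j) (M : ℕ) :
    ∑ y ∈ Fintype.piFinset fun _ : V => range (M + 3) with ¬ HasGap D y, ∏ u, w (y u) ≤
      (∑ j ∈ range (M + 3), w j) ^ Fintype.card V -
        r * (∑ j ∈ range M, w j) ^ Fintype.card V := by
  have htotal : (∑ j ∈ range (M + 3), w j) ^ Fintype.card V =
      ∑ y ∈ Fintype.piFinset fun _ : V => range (M + 3), ∏ u, w (y u) := by
    rw [← prod_univ_sum, prod_const, card_univ]
  rw [htotal, ← sum_filter_add_sum_filter_not
    (Fintype.piFinset fun _ : V => range (M + 3)) (HasGap D) fun y => ∏ u, w (y u)]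
  linarith [mul_pow_le_sum_hasGap D hw hr M]

theorem sum_geometric (p : ℝ) (N : ℕ) :
    ∑ j ∈ range N, p * (1 - p) ^ j = 1 - (1 - p) ^ N := by
  rw [← mul_sum, ← geom_sum_mul_neg, sub_sub_cancel, mul_comm]

theorem pow_sub_pow_le_mul_sub {a b : ℝ} (hb0 : 0 ≤ b) (hba : b ≤ a) (ha1 : a ≤ 1) (n : ℕ) :
    a ^ n - b ^ n ≤ n * (a - b) := by
  have hmax : max |a| |b| ≤ 1 := by
    rw [abs_of_nonneg (hb0.trans hba), abs_of_nonneg hb0, max_eq_left hba]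
    exact ha1
  calc a ^ n - b ^ n ≤ |a - b| * n * max |a| |b| ^ (n - 1) :=
        (le_abs_self _).trans (abs_pow_sub_pow_le a b n)
    _ ≤ (a - b) * n * 1 := by
        rw [abs_of_nonneg (sub_nonneg.2 hba)]
        gcongr
        exact pow_le_one₀ (by positivity) hmax
    _ = n * (a - b) := by ring

open Classical in
theorem sum_not_hasGap_geometric_le (D : V → ℕ) {p : ℝ} (hp0 : 0 ≤ p) (hp1 : p ≤ 1) {M : ℕ}
    (hM : Fintype.card V * (1 - p) ^ M ≤ 1) :
    ∑ y ∈ Fintype.piFinset fun _ : V => range (M + 3) with ¬ HasGap D y,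
      ∏ u, p * (1 - p) ^ y u ≤ 6 * p := by
  have hx0 : 0 ≤ 1 - p := sub_nonneg.2 hp1
  have hx1 : 1 - p ≤ 1 := sub_le_self 1 hp0
  have hcube : 1 - (1 - p) ^ 3 ≤ 3 * p := by nlinarith [mul_nonneg hp0 hp0, pow_nonneg hp0 3]
  have hcube0 : 0 ≤ 1 - (1 - p) ^ 3 := sub_nonneg.2 (pow_le_one₀ hx0 hx1)
  have hsum := sum_not_hasGap_le D (w := fun j => p * (1 - p) ^ j) (r := (1 - p) ^ 3)
    (fun j => by positivity) (fun j => by ring) M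
  rw [sum_geometric, sum_geometric] at hsum
  set a := 1 - (1 - p) ^ (M + 3)
  set b := 1 - (1 - p) ^ M
  have hb0 : 0 ≤ b := sub_nonneg.2 (pow_le_one₀ hx0 hx1)
  have hb1 : b ≤ 1 := sub_le_self 1 (by positivity)
  have ha1 : a ≤ 1 := sub_le_self 1 (by positivity)
  have hba : a - b = (1 - p) ^ M * (1 - (1 - p) ^ 3) := by ring
  have hba0 : 0 ≤ a - b := by rw [hba]; positivity
  have hpow := pow_sub_pow_le_mul_sub hb0 (sub_nonneg.1 hba0) ha1 (Fintype.card V)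
  calc _ ≤ a ^ Fintype.card V - (1 - p) ^ 3 * b ^ Fintype.card V := hsum
    _ = a ^ Fintype.card V - b ^ Fintype.card V
        + (1 - (1 - p) ^ 3) * b ^ Fintype.card V := by ring
    _ ≤ Fintype.card V * (a - b) + (1 - (1 - p) ^ 3) * 1 := by
        gcongr
        exact pow_le_one₀ hb0 hb1
    _ = (Fintype.card V * (1 - p) ^ M) * (1 - (1 - p) ^ 3) + (1 - (1 - p) ^ 3) := by
        rw [hba]; ring
    _ ≤ 1 * (1 - (1 - p) ^ 3) + (1 - (1 - p) ^ 3) := by gcongr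
    _ ≤ 6 * p := by linarith

end GapWeight

/-! ### Geometric variables from fair coins -/

section Geometric

open Finset

/-- For `a` uniform in the finite type `A`, the value `δ a` is distributed below `K` like a
geometric variable with success probability `p`: it is the number of failures before the first
success. Nothing is said about the values from `K` on, where the variable is truncated. -/
def IsTruncatedGeometric {A : Type*} [Fintype A] (δ : A → ℕ) (p : ℝ) (K : ℕ) : Prop :=
  ∀ j < K, (#{a | δ a = j} : ℝ) = Fintype.card A * (p * (1 - p) ^ j)

theorem IsTruncatedGeometric.comp_equiv {A A' : Type*} [Fintype A] [Fintype A'] {δ : A → ℕ} {p : ℝ}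
    {K : ℕ} (h : IsTruncatedGeometric δ p K) (e : A' ≃ A) :
    IsTruncatedGeometric (δ ∘ e) p K := by
  intro j hj
  rw [Fintype.card_congr e, ← h j hj]
  congr 1
  exact card_equiv e fun a => by simp only [mem_filter_univ, Function.comp_apply]

/-- The number of entries before the first occurrence of `s`; the length if there is none. -/
def failures {B : Type*} [DecidableEq B] (s : B) : (K : ℕ) → (Fin K → B) → ℕ
  | 0, _ => 0
  | K + 1, x => if x 0 = s then 0 else failures s K (Fin.tail x) + 1

theorem isTruncatedGeometric_failures {B : Type*} [DecidableEq B] [Fintype B] (s : B) (K : ℕ) :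
    IsTruncatedGeometric (failures s K) (Fintype.card B : ℝ)⁻¹ K := by
  have hq : 0 < Fintype.card B := Fintype.card_pos_iff.2 ⟨s⟩
  induction K with
  | zero => exact fun j hj => absurd hj (Nat.not_lt_zero j)
  | succ K ih =>
    have hcount (S : Finset B) (T : Finset (Fin K → B)) :
        #{x : Fin (K + 1) → B | x 0 ∈ S ∧ Fin.tail x ∈ T} = #S * #T := by
      rw [← card_product]
      exact card_equiv (Fin.consEquiv fun _ => B).symm fun x => by simp [Fin.consEquiv]
    intro j hj
    cases j with
    | zero =>
      have h := hcount {s} univ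
      simp only [mem_singleton, mem_univ, and_true, card_singleton, one_mul, card_univ] at h
      simp only [failures, ite_eq_left_iff, Nat.succ_ne_zero, imp_false, not_not, h,
        Fintype.card_pi, prod_const, card_univ, Fintype.card_fin, pow_zero, pow_succ]
      push_cast
      field_simp
    | succ j =>
      have h := hcount {s}ᶜ {x | failures s K x = j}
      simp only [mem_compl, mem_singleton, mem_filter_univ, card_compl, card_singleton] at h
      have hset (x : Fin (K + 1) → B) :
          failures s (K + 1) x = j + 1 ↔ ¬ x 0 = s ∧ failures s K (Fin.tail x) = j := by
        by_cases hx : x 0 = s <;> simp [failures, hx]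
      simp only [hset, h]
      push_cast [Nat.cast_sub (Nat.succ_le_of_lt hq)]
      rw [ih j (by omega)]
      simp only [Fintype.card_pi, prod_const, card_univ, Fintype.card_fin, pow_succ]
      push_cast
      field_simp

/-- A truncated geometric variable computed from `K * k` fair coins: the coins are tossed in `K`
blocks of length `k`, and the blocks before the first one without tails are counted. -/
def shift (k K : ℕ) (ω : Fin (K * k) → Bool) : ℕ :=
  failures (fun _ => true) K fun i (j : Fin k) => ω (finProdFinEquiv (i, j))

theorem isTruncatedGeometric_shift (k K : ℕ) :
    IsTruncatedGeometric (shift k K) (2 ^ k : ℝ)⁻¹ K := by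
  have h := (isTruncatedGeometric_failures (fun _ : Fin k => true) K).comp_equiv
    ((finProdFinEquiv.symm.arrowCongr (Equiv.refl Bool)).trans (Equiv.curry (Fin K) (Fin k) Bool))
  rwa [Fintype.card_fun, Fintype.card_bool, Fintype.card_fin, Nat.cast_pow, Nat.cast_ofNat] at h

variable {V A : Type*} [Fintype V] [DecidableEq V] [Fintype A] {δ : A → ℕ} {p : ℝ} {K M : ℕ}

theorem card_filter_comp (hδ : IsTruncatedGeometric δ p K) (Q : (V → ℕ) → Prop)
    [DecidablePred Q] :
    (#{ω : V → A | (∀ u, δ (ω u) < K) ∧ Q (δ ∘ ω)} : ℝ) =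
      Fintype.card (V → A) *
        ∑ y ∈ Fintype.piFinset fun _ : V => range K with Q y, ∏ u, p * (1 - p) ^ y u := by
  have hfiber (y : V → ℕ) : ({ω : V → A | δ ∘ ω = y} : Finset _) =
      Fintype.piFinset fun u => {a | δ a = y u} := by
    ext ω
    simp only [mem_filter_univ, Fintype.mem_piFinset, funext_iff, Function.comp_apply]
  rw [card_eq_sum_card_fiberwise (f := fun ω : V → A => δ ∘ ω)
    (t := (Fintype.piFinset fun _ : V => range K).filter Q), Nat.cast_sum, mul_sum]
  · refine sum_congr rfl fun y hy => ?_
    simp only [mem_filter, Fintype.mem_piFinset, mem_range] at hy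
    have hsub : ({ω : V → A | (∀ u, δ (ω u) < K) ∧ Q (δ ∘ ω)} : Finset _).filter
        (fun ω => δ ∘ ω = y) = ({ω : V → A | δ ∘ ω = y} : Finset _) := by
      rw [filter_filter]
      refine filter_congr fun ω _ => and_iff_right_of_imp ?_
      rintro rfl
      exact hy
    rw [hsub, hfiber, Fintype.card_piFinset, Nat.cast_prod,
      prod_congr rfl fun u _ => hδ (y u) (hy.1 u), prod_mul_distrib, prod_const, card_univ]
    simp only [Fintype.card_pi, prod_const, card_univ, Nat.cast_pow]
  · intro ω hω
    simpa using hω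

theorem one_sub_mul_card_le_card_forall_lt (hδ : IsTruncatedGeometric δ p K) (hp0 : 0 ≤ p)
    (hp1 : p ≤ 1) :
    (1 - Fintype.card V * (1 - p) ^ K) * Fintype.card (V → A) ≤
      (#{ω : V → A | ∀ u, δ (ω u) < K} : ℝ) := by
  have hbernoulli := one_add_mul_le_pow (a := -(1 - p) ^ K)
    (by linarith [pow_le_one₀ (n := K) (sub_nonneg.2 hp1) (sub_le_self 1 hp0)]) (Fintype.card V)
  have h := card_filter_comp (V := V) hδ fun _ => True
  simp only [and_true, filter_true] at h
  rw [h, ← prod_univ_sum (fun _ : V => range K) (fun _ j => p * (1 - p) ^ j), prod_const,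
    sum_geometric, card_univ, mul_comm]
  rw [← sub_eq_add_neg] at hbernoulli
  gcongr
  linarith

open Classical in
theorem card_not_hasGap_le [Nonempty V] (hδ : IsTruncatedGeometric δ p (M + 3)) (hp0 : 0 ≤ p)
    (hp1 : p ≤ 1) (hM : Fintype.card V * (1 - p) ^ M ≤ 1) (D : V → ℕ) :
    (#{ω : V → A | (∀ u, δ (ω u) < M + 3) ∧ ¬ HasGap D (δ ∘ ω)} : ℝ) ≤
      6 * p * Fintype.card (V → A) := by
  rw [card_filter_comp hδ fun y => ¬ HasGap D y, mul_comm]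
  gcongr
  exact sum_not_hasGap_geometric_le D hp0 hp1 hM

theorem card_mul_one_sub_pow_le (n k : ℕ) :
    (n : ℝ) * (1 - (2 ^ k : ℝ)⁻¹) ^ (2 ^ k * (Nat.clog 2 n + 3)) ≤ 1 / 8 := by
  have hq : (1 : ℝ) ≤ 2 ^ k := one_le_pow₀ one_le_two
  have hx0 : 0 ≤ 1 - (2 ^ k : ℝ)⁻¹ := sub_nonneg.2 (inv_le_one_of_one_le₀ hq)
  have hhalf : (1 - (2 ^ k : ℝ)⁻¹) ^ 2 ^ k ≤ 1 / 2 :=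
    calc (1 - (2 ^ k : ℝ)⁻¹) ^ 2 ^ k ≤ Real.exp (-1) := by
          simpa using Real.one_sub_div_pow_le_exp_neg (n := 2 ^ k) (t := 1) (by exact_mod_cast hq)
      _ ≤ 1 / 2 := by
          rw [Real.exp_neg, ← one_div]
          gcongr
          linarith [Real.add_one_le_exp (1 : ℝ)]
  have hn : (n : ℝ) ≤ 2 ^ Nat.clog 2 n := by exact_mod_cast Nat.le_pow_clog one_lt_two n
  calc (n : ℝ) * (1 - (2 ^ k : ℝ)⁻¹) ^ (2 ^ k * (Nat.clog 2 n + 3))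
      = n * ((1 - (2 ^ k : ℝ)⁻¹) ^ 2 ^ k) ^ (Nat.clog 2 n + 3) := by rw [pow_mul]
    _ ≤ 2 ^ Nat.clog 2 n * (1 / 2) ^ (Nat.clog 2 n + 3) := by gcongr
    _ = 1 / 8 := by
      rw [pow_add, ← mul_assoc, ← mul_pow]
      norm_num

theorem mul_card_filter_le_of_forall_card_le {Ω ι : Type*} {S : Finset Ω} {E : Finset ι}
    (hE : E.Nonempty) (R : Ω → ι → Prop) [∀ ω e, Decidable (R ω e)] (ε b : ℝ)
    (hb : ∀ e ∈ E, (#{ω ∈ S | R ω e} : ℝ) ≤ b) :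
    ε * #{ω ∈ S | ε * #E ≤ #{e ∈ E | R ω e}} ≤ b := by
  have hE0 : (0 : ℝ) < #E := by exact_mod_cast hE.card_pos
  refine le_of_mul_le_mul_left ?_ hE0
  calc (#E : ℝ) * (ε * #{ω ∈ S | ε * #E ≤ #{e ∈ E | R ω e}})
      = #{ω ∈ S | ε * #E ≤ #{e ∈ E | R ω e}} • (ε * #E) := by rw [nsmul_eq_mul]; ring
    _ ≤ ∑ ω ∈ S with ε * #E ≤ #{e ∈ E | R ω e}, (#{e ∈ E | R ω e} : ℝ) :=
        card_nsmul_le_sum _ _ _ fun ω hω => (mem_filter.1 hω).2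
    _ ≤ ∑ ω ∈ S, (#{e ∈ E | R ω e} : ℝ) :=
        sum_le_sum_of_subset_of_nonneg (filter_subset _ _) fun _ _ _ => Nat.cast_nonneg _
    _ = ∑ e ∈ E, (#{ω ∈ S | R ω e} : ℝ) := by
        exact_mod_cast sum_card_bipartiteAbove_eq_sum_card_bipartiteBelow R
    _ ≤ #E * b := (sum_le_card_nsmul _ _ _ hb).trans_eq (nsmul_eq_mul _ _)

open Classical in
theorem two_thirds_le_card_shifts [Nonempty V] {ι : Type*} {ε : ℝ} {k : ℕ} (hk : 36 ≤ ε * 2 ^ k)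
    (hM : M = 2 ^ k * (Nat.clog 2 (Fintype.card V) + 3))
    (hδ : IsTruncatedGeometric δ (2 ^ k : ℝ)⁻¹ (M + 3))
    {E : Finset ι} (hE : E.Nonempty) (D : ι → V → ℕ) :
    2 / 3 * (Fintype.card (V → A) : ℝ) ≤
      #{ω : V → A | (∀ u, δ (ω u) < M + 3) ∧
        (#{e ∈ E | ¬ HasGap (D e) (δ ∘ ω)} : ℝ) < ε * #E} := by
  set p : ℝ := (2 ^ k : ℝ)⁻¹ with hp
  have hp0 : 0 ≤ p := by positivity
  have hp1 : p ≤ 1 := inv_le_one_of_one_le₀ (one_le_pow₀ one_le_two)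
  have hpε : 36 * p ≤ ε := (le_mul_inv_iff₀ (by positivity)).1 (by simpa [hp] using hk)
  have hε : 0 < ε := lt_of_lt_of_le (by positivity) hpε
  have hnM : Fintype.card V * (1 - p) ^ M ≤ 1 / 8 := hM ▸ card_mul_one_sub_pow_le _ _
  set N : ℝ := (Fintype.card (V → A) : ℝ) with hN
  set S : Finset (V → A) := {ω | ∀ u, δ (ω u) < M + 3} with hS
  have huntruncated : 7 / 8 * N ≤ #S := by
    refine le_trans ?_ (one_sub_mul_card_le_card_forall_lt hδ hp0 hp1)
    have hle : (1 - p) ^ (M + 3) ≤ (1 - p) ^ M :=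
      pow_le_pow_of_le_one (sub_nonneg.2 hp1) (sub_le_self 1 hp0) (Nat.le_add_right M 3)
    gcongr
    linarith [mul_le_mul_of_nonneg_left hle (Nat.cast_nonneg (α := ℝ) (Fintype.card V))]
  have hmarkov : ε * #{ω ∈ S | ε * #E ≤ #{e ∈ E | ¬ HasGap (D e) (δ ∘ ω)}} ≤ 6 * p * N :=
    mul_card_filter_le_of_forall_card_le hE (fun ω e => ¬ HasGap (D e) (δ ∘ ω)) ε _ fun e _ => by
      rw [hS, filter_filter]
      exact card_not_hasGap_le hδ hp0 hp1 (by linarith) (D e)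
  have hbad : (#{ω ∈ S | ε * #E ≤ #{e ∈ E | ¬ HasGap (D e) (δ ∘ ω)}} : ℝ) ≤ 1 / 6 * N := by
    refine le_of_mul_le_mul_left (hmarkov.trans ?_) hε
    have hN0 : 0 ≤ N := hN ▸ Nat.cast_nonneg _
    linarith [mul_le_mul_of_nonneg_right hpε hN0]
  have hsplit : (#{ω ∈ S | ε * #E ≤ #{e ∈ E | ¬ HasGap (D e) (δ ∘ ω)}} : ℝ) +
      #{ω ∈ S | ¬ ε * #E ≤ #{e ∈ E | ¬ HasGap (D e) (δ ∘ ω)}} = #S := by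
    exact_mod_cast card_filter_add_card_filter_not (s := S) _
  simp only [not_le] at hsplit
  rw [← filter_filter, ← hS]
  linarith

end Geometric

/-! ### Numbering the vertices of a forest -/

/-- A spanning forest of depth at most `L` on the vertex set `V`: vertices belong to the same tree
if they have the same `center`, and `level` is the distance to the root, the vertex without
`parent`. -/
structure RootedForest (V : Type*) (L : ℕ) where
  center : V → ℕ
  parent : V → Option V
  level : V → ℕ
  center_parent : ∀ {v w}, parent v = some w → center w = center v
  level_parent : ∀ {v w}, parent v = some w → level w + 1 = level v
  root_unique : ∀ {v w}, parent v = none → parent w = none → center v = center w → v = w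
  level_le : ∀ v, level v ≤ L

namespace RootedForest

section Root

variable {V : Type*} {L : ℕ} (F : RootedForest V L)

theorem exists_root (v : V) :
    ∃ r, F.parent r = none ∧ F.center r = F.center v ∧ F.level r ≤ F.level v ∧
      (F.level r = F.level v → r = v) := by
  induction hl : F.level v using Nat.strong_induction_on generalizing v with
  | _ l ih =>
    subst hl
    rcases hv : F.parent v with _ | w
    · exact ⟨v, hv, rfl, le_rfl, fun _ => rfl⟩
    · have hlevel := F.level_parent hv
      obtain ⟨r, hr, hcenter, hle, -⟩ := ih (F.level w) (by omega) w rfl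
      exact ⟨r, hr, hcenter.trans (F.center_parent hv), by omega, fun _ => by omega⟩

theorem level_root_lt {r v : V} (hr : F.parent r = none) (hc : F.center r = F.center v)
    (hne : r ≠ v) : F.level r < F.level v := by
  obtain ⟨r', hr', hc', hle, heq⟩ := F.exists_root v
  obtain rfl := F.root_unique hr hr' (hc.trans hc'.symm)
  exact lt_of_le_of_ne hle fun h => hne (heq h)

end Root

open Finset

variable {V : Type*} [Fintype V] [DecidableEq V] {L : ℕ} (F : RootedForest V L)

/-- The number of vertices in the subtree below `v`, including `v`. -/
def size (v : V) : ℕ :=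
  1 + ∑ u : {u // F.parent u = some v}, size u
termination_by L - F.level v
decreasing_by
  have := F.level_parent u.2
  have := F.level_le u
  omega

/-- The position of `v` in the preorder traversal of its tree, starting from `0`, where the
children of a vertex are visited in the order of `ident`. -/
def label (ident : V → ℕ) (v : V) : ℕ :=
  match _h : F.parent v with
  | none => 0
  | some w => label ident w + 1 + ∑ u with F.parent u = some w ∧ ident u < ident v, F.size u
termination_by F.level v
decreasing_by
  have := F.level_parent _h
  omega

theorem size_eq (v : V) : F.size v = 1 + ∑ u with F.parent u = some v, F.size u := by
  rw [size, sum_subtype _ (fun u => mem_filter_univ u) F.size]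

theorem size_pos (v : V) : 0 < F.size v := by
  rw [size_eq]
  omega

theorem size_root {r : V} (hr : F.parent r = none) :
    F.size r = #{v | F.center v = F.center r} := by
  set T : Finset V := {v | F.center v = F.center r} with hT
  have hchildren : ∑ v ∈ T, ∑ u with F.parent u = some v, F.size u = ∑ u ∈ T.erase r, F.size u := by
    rw [← sum_biUnion]
    · refine sum_congr (ext fun u => ?_) fun _ _ => rfl
      simp only [hT, mem_biUnion, mem_filter_univ, mem_erase]
      constructor
      · rintro ⟨v, hv, hu⟩
        exact ⟨by rintro rfl; exact Option.some_ne_none v (hu.symm.trans hr),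
          (F.center_parent hu).symm.trans hv⟩
      · rintro ⟨hne, hu⟩
        rcases hp : F.parent u with _ | v
        · exact absurd (F.root_unique hp hr hu) hne
        · exact ⟨v, (F.center_parent hp).trans hu, rfl⟩
    · intro v _ v' _ hne
      refine disjoint_left.2 fun u hu hu' => hne ?_
      simp only [mem_filter_univ] at hu hu'
      exact Option.some_injective _ (hu.symm.trans hu')
  have htotal : ∑ v ∈ T, F.size v = #T + ∑ u ∈ T.erase r, F.size u := by
    rw [sum_congr rfl fun v _ => F.size_eq v, sum_add_distrib, hchildren, card_eq_sum_ones]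
  have hroot := add_sum_erase T F.size (a := r) (by simp only [hT, mem_filter_univ])
  omega

variable (ident : V → ℕ)

theorem label_of_parent_eq_none {v : V} (h : F.parent v = none) : F.label ident v = 0 := by
  rw [label]
  split <;> simp_all only [reduceCtorEq]

theorem label_of_parent_eq_some {v w : V} (h : F.parent v = some w) :
    F.label ident v =
      F.label ident w + 1 + ∑ u with F.parent u = some w ∧ ident u < ident v, F.size u := by
  rw [label]
  split <;> simp_all only [reduceCtorEq, Option.some.injEq]

theorem interval_child_subset {v w : V} (h : F.parent v = some w) :
    F.label ident w < F.label ident v ∧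
      F.label ident v + F.size v ≤ F.label ident w + F.size w := by
  have hlabel := F.label_of_parent_eq_some ident h
  have hsize := F.size_eq w
  have hsum : ∑ u with F.parent u = some w ∧ ident u < ident v, F.size u + F.size v ≤
      ∑ u with F.parent u = some w, F.size u := by
    rw [add_comm, ← sum_insert (f := F.size) (by simp)]
    refine sum_le_sum_of_subset fun u hu => ?_
    simp only [mem_insert, mem_filter_univ] at hu ⊢
    exact hu.elim (· ▸ h) And.left
  omega

theorem interval_sibling_le {v v' w : V} (h : F.parent v = some w) (h' : F.parent v' = some w)
    (hlt : ident v < ident v') : F.label ident v + F.size v ≤ F.label ident v' := by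
  have hlabel := F.label_of_parent_eq_some ident h
  have hlabel' := F.label_of_parent_eq_some ident h'
  have hsum : ∑ u with F.parent u = some w ∧ ident u < ident v, F.size u + F.size v ≤
      ∑ u with F.parent u = some w ∧ ident u < ident v', F.size u := by
    rw [add_comm, ← sum_insert (f := F.size) (by simp)]
    refine sum_le_sum_of_subset fun u hu => ?_
    simp only [mem_insert, mem_filter_univ] at hu ⊢
    rcases hu with rfl | hu
    · exact ⟨h, hlt⟩
    · exact ⟨hu.1, hu.2.trans hlt⟩
  omega

variable {ident}

theorem interval_disjoint_of_level_eq (hid : Function.Injective ident) {u v : V}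
    (hl : F.level u = F.level v) (hc : F.center u = F.center v) (hne : u ≠ v) :
    F.label ident u + F.size u ≤ F.label ident v ∨
      F.label ident v + F.size v ≤ F.label ident u := by
  induction h : F.level u using Nat.strong_induction_on generalizing u v with
  | _ l ih =>
    rcases hu : F.parent u with _ | w
    · have := F.level_root_lt hu hc hne
      omega
    rcases hv : F.parent v with _ | w'
    · have := F.level_root_lt hv hc.symm hne.symm
      omega
    by_cases hw : w = w'
    · subst hw
      exact (lt_or_gt_of_ne fun h => hne (hid h)).imp (F.interval_sibling_le ident hu hv)
        (F.interval_sibling_le ident hv hu)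
    · have := F.level_parent hu
      have := F.level_parent hv
      have := F.interval_child_subset ident hu
      have := F.interval_child_subset ident hv
      have := ih (F.level w) (by omega) (u := w) (v := w') (by omega)
        (by rw [F.center_parent hu, F.center_parent hv, hc]) hw rfl
      omega

theorem interval_disjoint_or_subset (hid : Function.Injective ident) {u v : V}
    (hl : F.level u ≤ F.level v) (hc : F.center u = F.center v) (hne : u ≠ v) :
    F.label ident u + F.size u ≤ F.label ident v ∨
      F.label ident v + F.size v ≤ F.label ident u ∨
      (F.label ident u < F.label ident v ∧
        F.label ident v + F.size v ≤ F.label ident u + F.size u) := by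
  induction h : F.level v using Nat.strong_induction_on generalizing v with
  | _ l ih =>
    rcases hl.eq_or_lt with hl | hl
    · exact (F.interval_disjoint_of_level_eq hid hl hc hne).imp_right .inl
    rcases hv : F.parent v with _ | w
    · have := F.level_root_lt hv hc.symm hne.symm
      omega
    have := F.level_parent hv
    have hchild := F.interval_child_subset ident hv
    by_cases hw : u = w
    · subst hw
      exact .inr (.inr hchild)
    · have := ih (F.level w) (by omega) (v := w) (by omega) (by rw [F.center_parent hv, hc]) hw rfl
      omega

theorem label_ne_label (hid : Function.Injective ident) {u v : V} (hc : F.center u = F.center v)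
    (hne : u ≠ v) : F.label ident u ≠ F.label ident v := by
  have := F.size_pos u
  have := F.size_pos v
  rcases le_total (F.level u) (F.level v) with hl | hl
  · have := F.interval_disjoint_or_subset hid hl hc hne
    omega
  · have := F.interval_disjoint_or_subset hid hl hc.symm hne.symm
    omega

theorem injective_label (hid : Function.Injective ident) (k : ℕ) :
    Function.Injective fun u : {u | F.center u = k} => F.label ident u := by
  intro u v h
  by_contra hne
  exact F.label_ne_label hid (u.2.trans v.2.symm) (Subtype.coe_ne_coe.2 hne) h

theorem label_add_size_le (ident : V → ℕ) (v : V) :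
    F.label ident v + F.size v ≤ #{u | F.center u = F.center v} := by
  induction h : F.level v using Nat.strong_induction_on generalizing v with
  | _ l ih =>
    rcases hv : F.parent v with _ | w
    · rw [F.label_of_parent_eq_none ident hv, F.size_root hv, zero_add]
    · have := F.level_parent hv
      have hchild := F.interval_child_subset ident hv
      have := ih (F.level w) (by omega) w rfl
      rw [F.center_parent hv] at this
      omega

theorem label_lt (ident : V → ℕ) (v : V) :
    F.label ident v < #{u | F.center u = F.center v} := by
  have := F.size_pos v
  have := F.label_add_size_le ident v
  omega

theorem label_add_size_le_card (ident : V → ℕ) (v : V) :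
    F.label ident v + F.size v ≤ Fintype.card V :=
  (F.label_add_size_le ident v).trans (card_le_univ _)

end RootedForest

/-! ### Protocols of fixed duration -/

namespace DistAlgorithm

variable {V : Type} [Fintype V] {G : SimpleGraph V} {ident : V → ℕ} {A : DistAlgorithm}
  {ω : A.Coins V}

theorem stateAt_of_le {t t' : ℕ} {v : V} (h : (A.verdict G ident ω t v).isSome) (htt' : t ≤ t') :
    A.stateAt G ident ω t' v = A.stateAt G ident ω t v := by
  induction t', htt' using Nat.le_induction with
  | base => rfl
  | succ m _ ih =>
    rw [verdict] at h
    rw [stateAt, ih, if_pos h]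

theorem isSome_verdict_of_le {t t' : ℕ} {v : V} (h : (A.verdict G ident ω t v).isSome)
    (htt' : t ≤ t') : (A.verdict G ident ω t' v).isSome := by
  rwa [verdict, stateAt_of_le h htt']

theorem outputs_iff {t : ℕ} {v : V} (h : (A.verdict G ident ω t v).isSome) (b : Bool) :
    A.Outputs G ident ω v b ↔ A.verdict G ident ω t v = some b := by
  refine ⟨?_, fun h => ⟨t, h⟩⟩
  rintro ⟨t', ht'⟩
  rw [← ht', verdict, verdict]
  rcases le_total t t' with hle | hle
  · rw [stateAt_of_le h hle]
  · rw [stateAt_of_le (Option.isSome_of_eq_some ht') hle]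

open Classical in
theorem le_rejectProb (p : ℝ) (S : Finset (A.Coins V))
    (hS : p * Fintype.card (A.Coins V) ≤ S.card)
    (hreject : ∀ ω ∈ S, ∃ v, A.Outputs G ident ω v false) : p ≤ A.rejectProb G ident := by
  rw [rejectProb, le_div_iff₀ (by exact_mod_cast Fintype.card_pos)]
  refine hS.trans ?_
  rw [Fintype.card_subtype]
  exact_mod_cast Finset.card_le_card fun ω hω => Finset.mem_filter_univ ω |>.2 (hreject ω hω)

end DistAlgorithm

/-- The message `m`, replaced by the empty message if it has more than `b` bits. -/
def clip (b m : ℕ) : ℕ := if m.size ≤ b then m else 0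

theorem clip_of_size_le {b m : ℕ} (h : m.size ≤ b) : clip b m = m := if_pos h

theorem size_clip_le (b m : ℕ) : (clip b m).size ≤ b := by
  unfold clip
  split_ifs with h
  · exact h
  · exact (Nat.size_zero).trans_le (Nat.zero_le b)

theorem size_le_mul_clog {n e m : ℕ} (h : m < n ^ e) : m.size ≤ e * Nat.clog 2 n := by
  rw [Nat.size_le]
  calc m < n ^ e := h
    _ ≤ (2 ^ Nat.clog 2 n) ^ e := Nat.pow_le_pow_left (Nat.le_pow_clog one_lt_two n) e
    _ = 2 ^ (e * Nat.clog 2 n) := by rw [← pow_mul, mul_comm]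

/-- The inbox of `v` when every neighbour `u` sends the message `m u`, clipped to `b` bits. -/
noncomputable def deliver {V : Type*} (b : ℕ) (G : SimpleGraph V) (ident : V → ℕ) (v : V)
    (m : V → ℕ) : ℕ → ℕ :=
  Function.extend (fun u : G.neighborSet v => ident u) (fun u => clip b (m u)) fun _ => 0

theorem deliver_ident {V : Type*} {b : ℕ} {G : SimpleGraph V} {ident : V → ℕ}
    (hid : Function.Injective ident) {u v : V} (h : G.Adj v u) {m : V → ℕ} {a : ℕ} (hm : m u = a)
    (ha : a.size ≤ b) : deliver b G ident v m (ident u) = a :=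
  (Function.Injective.extend_apply (f := fun u : G.neighborSet v => ident u)
    (fun _ _ h => Subtype.ext (hid h)) _ _ ⟨u, h⟩).trans
    ((congrArg (clip b) hm).trans (clip_of_size_le ha))

/-- A synchronous protocol that runs for a fixed number of rounds on processors with memory `X`.
In round `t < rounds`, a processor with memory `x` sends `send t x i` to its neighbour with ID `i`,
and passes to the memory `update t x inbox`. -/
structure Protocol (X : Type*) where
  rounds : ℕ
  send : ℕ → X → ℕ → ℕ
  update : ℕ → X → (ℕ → ℕ) → X

namespace Protocol

variable {X V : Type*}

/-- The protocol that does nothing. -/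
def idle (X : Type*) : Protocol X where
  rounds := 0
  send _ _ _ := 0
  update _ x _ := x

/-- The protocol that runs `Q` and then `Q'`. -/
def andThen (Q Q' : Protocol X) : Protocol X where
  rounds := Q.rounds + Q'.rounds
  send t := if t < Q.rounds then Q.send t else Q'.send (t - Q.rounds)
  update t := if t < Q.rounds then Q.update t else Q'.update (t - Q.rounds)

/-- The memories after `t` rounds in the network `G`, starting from the memories `x`, when messages
are clipped to `b` bits. -/
noncomputable def run (Q : Protocol X) (b : ℕ) (G : SimpleGraph V) (ident : V → ℕ) (x : V → X) :
    ℕ → V → X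
  | 0 => x
  | t + 1 => fun v => Q.update t (Q.run b G ident x t v)
      (deliver b G ident v fun u => Q.send t (Q.run b G ident x t u) (ident v))

/-- The memories after all rounds of the protocol. -/
noncomputable def result (Q : Protocol X) (b : ℕ) (G : SimpleGraph V) (ident : V → ℕ) (x : V → X) :
    V → X :=
  Q.run b G ident x Q.rounds

variable (Q Q' : Protocol X) (b : ℕ) (G : SimpleGraph V) (ident : V → ℕ) (x : V → X)

theorem run_andThen_of_le {t : ℕ} (ht : t ≤ Q.rounds) :
    (Q.andThen Q').run b G ident x t = Q.run b G ident x t := by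
  induction t with
  | zero => rfl
  | succ t ih =>
    have htQ : t < Q.rounds := ht
    simp only [run, ih htQ.le]
    simp only [andThen, if_pos htQ]

theorem run_andThen_add (t : ℕ) :
    (Q.andThen Q').run b G ident x (Q.rounds + t) =
      Q'.run b G ident (Q.result b G ident x) t := by
  induction t with
  | zero => exact Q.run_andThen_of_le Q' b G ident x le_rfl
  | succ t ih =>
    rw [← Nat.add_assoc]
    simp only [run, ih]
    simp only [andThen, if_neg (Nat.not_lt.2 (Nat.le_add_right Q.rounds t)),
      Nat.add_sub_cancel_left]

theorem result_andThen :
    (Q.andThen Q').result b G ident x = Q'.result b G ident (Q.result b G ident x) :=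
  Q.run_andThen_add Q' b G ident x Q'.rounds

end Protocol

/-- A distributed algorithm whose duration is determined by the number `n` of processors: they run
`protocol n` with messages of at most `width n` bits and then evaluate `accept n`. -/
structure FixedTimeAlgorithm where
  Memory : Type
  coins : ℕ → ℕ
  init : (n : ℕ) → (ownId : ℕ) → (nbrIds : Finset ℕ) → (Fin (coins n) → Bool) → Memory
  protocol : ℕ → Protocol Memory
  width : ℕ → ℕ
  accept : ℕ → Memory → Bool

namespace FixedTimeAlgorithm

noncomputable section

variable (T : FixedTimeAlgorithm)

/-- The distributed algorithm in which the processors also store the number of processors and the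
number of rounds completed. -/
def toAlgorithm : DistAlgorithm where
  State := ℕ × ℕ × T.Memory
  coins := T.coins
  init n i s ω := (n, 0, T.init n i s ω)
  send s i := clip (T.width s.1) ((T.protocol s.1).send s.2.1 s.2.2 i)
  step s inbox := (s.1, s.2.1 + 1, (T.protocol s.1).update s.2.1 s.2.2 inbox)
  output s := if (T.protocol s.1).rounds ≤ s.2.1 then some (T.accept s.1 s.2.2) else none

variable {V : Type} [Fintype V] (G : SimpleGraph V) (ident : V → ℕ)

open Classical in
/-- The memories of the processors before the first round. -/
def initial (ω : V → Fin (T.coins (Fintype.card V)) → Bool) (v : V) : T.Memory :=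
  T.init (Fintype.card V) (ident v) ((G.neighborFinset v).image ident) (ω v)

/-- The memories of the processors when they stop. -/
def final (ω : V → Fin (T.coins (Fintype.card V)) → Bool) : V → T.Memory :=
  (T.protocol (Fintype.card V)).result (T.width (Fintype.card V)) G ident (T.initial G ident ω)

variable {G ident}

theorem stateAt_eq (ω : T.toAlgorithm.Coins V) {t : ℕ}
    (ht : t ≤ (T.protocol (Fintype.card V)).rounds) (v : V) :
    T.toAlgorithm.stateAt G ident ω t v = (Fintype.card V, t,
      (T.protocol (Fintype.card V)).run (T.width (Fintype.card V)) G ident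
        (T.initial G ident ω) t v) := by
  induction t generalizing v with
  | zero => rfl
  | succ t ih =>
    have hrunning (u : V) :
        ¬ (T.toAlgorithm.output (T.toAlgorithm.stateAt G ident ω t u)).isSome := by
      rw [ih (by omega) u]
      simpa [toAlgorithm] using ht
    have hmessage (u : V) : T.toAlgorithm.message (T.toAlgorithm.stateAt G ident ω t u) (ident v) =
        T.toAlgorithm.send (T.toAlgorithm.stateAt G ident ω t u) (ident v) := if_neg (hrunning u)
    rw [DistAlgorithm.stateAt, if_neg (hrunning v)]
    simp only [hmessage]
    simp only [ih (Nat.le_of_succ_le ht)]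
    rfl

theorem verdict_rounds (ω : T.toAlgorithm.Coins V) (v : V) :
    T.toAlgorithm.verdict G ident ω (T.protocol (Fintype.card V)).rounds v =
      some (T.accept (Fintype.card V) (T.final G ident ω v)) := by
  rw [DistAlgorithm.verdict, T.stateAt_eq ω le_rfl]
  exact if_pos le_rfl

theorem haltsWithin_rounds :
    T.toAlgorithm.HaltsWithin (T.protocol (Fintype.card V)).rounds G ident := fun ω v =>
  Option.isSome_of_eq_some (T.verdict_rounds ω v)

theorem outputs_iff (ω : T.toAlgorithm.Coins V) (v : V) (b : Bool) :
    T.toAlgorithm.Outputs G ident ω v b ↔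
      T.accept (Fintype.card V) (T.final G ident ω v) = b := by
  rw [DistAlgorithm.outputs_iff (T.haltsWithin_rounds ω v), verdict_rounds, Option.some_inj]

theorem stateAt_fst (ω : T.toAlgorithm.Coins V) (t : ℕ) (v : V) :
    (T.toAlgorithm.stateAt G ident ω t v).1 = Fintype.card V := by
  induction t with
  | zero => rfl
  | succ t ih =>
    rw [DistAlgorithm.stateAt]
    split <;> exact ih

theorem respectsBandwidth {B : ℕ}
    (h : T.width (Fintype.card V) = B * Nat.clog 2 (Fintype.card V)) :
    T.toAlgorithm.RespectsBandwidth B G ident := by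
  intro ω t u v _
  rw [DistAlgorithm.message]
  split_ifs
  · exact (Nat.size_zero).trans_le (Nat.zero_le _)
  · rw [← h, ← T.stateAt_fst ω t u]
    exact size_clip_le _ _

end

end FixedTimeAlgorithm

/-! ### Clustering by flooding -/

section Flooding

variable {V : Type*}

/-- What a vertex knows about its cluster during the flooding: the center of the cluster, the
vertex from which it heard of the cluster, and the round in which it joined. A vertex is stored as
its ID plus `1`; the `center` is `0` as long as the vertex is in no cluster, and the `parent` of a
center is `0`. -/
structure FloodRecord where
  center : ℕ
  parent : ℕ
  level : ℕ

/-- The possible outcomes for `v` of the flooding round from time `t` to `t + 1`: a vertex in a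
cluster stays there; any other vertex joins the cluster of a neighbour if it can, and otherwise
founds its own cluster once its start time has come. -/
inductive FloodStep (G : SimpleGraph V) (ident start : V → ℕ) (t : ℕ) (m : V → FloodRecord)
    (v : V) : FloodRecord → Prop
  | keep (hv : (m v).center ≠ 0) : FloodStep G ident start t m v (m v)
  | join {w : V} (hv : (m v).center = 0) (hadj : G.Adj v w) (hw : (m w).center ≠ 0) :
      FloodStep G ident start t m v ⟨(m w).center, ident w + 1, t + 1⟩
  | found (hv : (m v).center = 0) (hnbr : ∀ w, G.Adj v w → (m w).center = 0) (ht : start v ≤ t) :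
      FloodStep G ident start t m v ⟨ident v + 1, 0, t + 1⟩
  | wait (hv : (m v).center = 0) (hnbr : ∀ w, G.Adj v w → (m w).center = 0) (ht : t < start v) :
      FloodStep G ident start t m v (m v)

namespace FloodStep

variable {G : SimpleGraph V} {ident start : V → ℕ} {t : ℕ} {m : V → FloodRecord} {v : V}
  {x : FloodRecord}

theorem eq_of_center_ne_zero (h : FloodStep G ident start t m v x) (hv : (m v).center ≠ 0) :
    x = m v := by
  cases h <;> first | rfl | contradiction

theorem level_eq (h : FloodStep G ident start t m v x) (hv : (m v).center = 0)
    (hx : x.center ≠ 0) : x.level = t + 1 := by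
  cases h <;> first | rfl | contradiction

end FloodStep

/-- The invariant of the flooding after `t` rounds. Levels measure when a vertex was reached: the
flood needs at least `q.length` rounds along a walk `q`, and neighbouring levels differ by at
most one. -/
structure FloodInvariant (G : SimpleGraph V) (ident start : V → ℕ) (t : ℕ)
    (m : V → FloodRecord) : Prop where
  level_le : ∀ v, (m v).center ≠ 0 → (m v).level ≤ t
  exists_walk : ∀ v, (m v).center ≠ 0 → ∃ (u : V) (q : G.Walk u v),
    (m v).center = ident u + 1 ∧ start u + 1 + q.length ≤ (m v).level
  parent : ∀ v, (m v).center ≠ 0 → ((m v).parent = 0 ∧ (m v).center = ident v + 1) ∨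
    ∃ w, G.Adj v w ∧ (m v).parent = ident w + 1 ∧ (m w).center = (m v).center ∧
      (m w).level + 1 = (m v).level
  fresh : ∀ v, (m v).center = 0 →
    t ≤ start v ∧ ∀ w, G.Adj v w → (m w).center ≠ 0 → (m w).level = t
  level_le_start : ∀ v, (m v).center ≠ 0 → (m v).level ≤ start v + 1
  level_le_adj : ∀ v w, G.Adj v w → (m v).center ≠ 0 → (m w).center ≠ 0 →
    (m v).level ≤ (m w).level + 1

namespace FloodInvariant

variable {G : SimpleGraph V} {ident start : V → ℕ} {t : ℕ} {m m' : V → FloodRecord}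

theorem of_center_eq_zero (h : ∀ v, (m v).center = 0) : FloodInvariant G ident start 0 m where
  level_le v hv := absurd (h v) hv
  exists_walk v hv := absurd (h v) hv
  parent v hv := absurd (h v) hv
  fresh _ _ := ⟨Nat.zero_le _, fun w _ hw => absurd (h w) hw⟩
  level_le_start v hv := absurd (h v) hv
  level_le_adj v _ _ hv := absurd (h v) hv

theorem level_le_step (hI : FloodInvariant G ident start t m)
    (hs : ∀ v, FloodStep G ident start t m v (m' v)) (v : V) (hv : (m' v).center ≠ 0) :
    (m' v).level ≤ t + 1 := by
  by_cases h : (m v).center = 0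
  · exact ((hs v).level_eq h hv).le
  · rw [(hs v).eq_of_center_ne_zero h]
    exact (hI.level_le v h).trans t.le_succ

theorem exists_walk_step (hI : FloodInvariant G ident start t m)
    (hs : ∀ v, FloodStep G ident start t m v (m' v)) (v : V) (hv : (m' v).center ≠ 0) :
    ∃ (u : V) (q : G.Walk u v),
      (m' v).center = ident u + 1 ∧ start u + 1 + q.length ≤ (m' v).level := by
  have hstep := hs v
  generalize m' v = x at hstep hv ⊢
  cases hstep with
  | keep h => exact hI.exists_walk v h
  | @join w _ hadj hw =>
    obtain ⟨u, q, hu, hq⟩ := hI.exists_walk w hw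
    have hlevel := hI.level_le w hw
    refine ⟨u, q.concat hadj.symm, hu, ?_⟩
    rw [SimpleGraph.Walk.length_concat]
    dsimp only
    omega
  | found _ _ ht => exact ⟨v, .nil, rfl, Nat.succ_le_succ ht⟩
  | wait h => exact absurd h hv

theorem parent_step (hI : FloodInvariant G ident start t m)
    (hs : ∀ v, FloodStep G ident start t m v (m' v)) (v : V) (hv : (m' v).center ≠ 0) :
    ((m' v).parent = 0 ∧ (m' v).center = ident v + 1) ∨
      ∃ w, G.Adj v w ∧ (m' v).parent = ident w + 1 ∧ (m' w).center = (m' v).center ∧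
        (m' w).level + 1 = (m' v).level := by
  have hstep := hs v
  generalize m' v = x at hstep hv ⊢
  cases hstep with
  | keep h =>
    refine (hI.parent v h).imp_right fun ⟨w, hadj, hparent, hcenter, hlevel⟩ => ?_
    have hw := (hs w).eq_of_center_ne_zero (hcenter ▸ h)
    exact ⟨w, hadj, hparent, by rw [hw, hcenter], by rw [hw, hlevel]⟩
  | @join w h hadj hw =>
    refine .inr ⟨w, hadj, rfl, ?_⟩
    rw [(hs w).eq_of_center_ne_zero hw]
    exact ⟨rfl, congrArg (· + 1) ((hI.fresh v h).2 w hadj hw)⟩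
  | found => exact .inl ⟨rfl, rfl⟩
  | wait h => exact absurd h hv

theorem fresh_step (hs : ∀ v, FloodStep G ident start t m v (m' v)) (v : V)
    (hv : (m' v).center = 0) :
    t + 1 ≤ start v ∧ ∀ w, G.Adj v w → (m' w).center ≠ 0 → (m' w).level = t + 1 := by
  have hstep := hs v
  generalize m' v = x at hstep hv
  cases hstep with
  | keep h => exact absurd hv h
  | join _ _ hw => exact absurd hv hw
  | found => exact absurd hv (Nat.succ_ne_zero _)
  | wait _ hnbr ht => exact ⟨ht, fun w hadj => (hs w).level_eq (hnbr w hadj)⟩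

theorem level_le_start_step (hI : FloodInvariant G ident start t m)
    (hs : ∀ v, FloodStep G ident start t m v (m' v)) (v : V) (hv : (m' v).center ≠ 0) :
    (m' v).level ≤ start v + 1 := by
  by_cases h : (m v).center = 0
  · rw [(hs v).level_eq h hv]
    exact Nat.succ_le_succ (hI.fresh v h).1
  · rw [(hs v).eq_of_center_ne_zero h]
    exact hI.level_le_start v h

theorem level_le_adj_step (hI : FloodInvariant G ident start t m)
    (hs : ∀ v, FloodStep G ident start t m v (m' v)) (v w : V) (hadj : G.Adj v w)
    (hv : (m' v).center ≠ 0) (hw : (m' w).center ≠ 0) : (m' v).level ≤ (m' w).level + 1 := by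
  by_cases h : (m v).center = 0 <;> by_cases h' : (m w).center = 0
  · rw [(hs v).level_eq h hv, (hs w).level_eq h' hw]
    exact Nat.le_succ _
  · rw [(hs v).level_eq h hv, (hs w).eq_of_center_ne_zero h', (hI.fresh v h).2 w hadj h']
  · have hlevel := hI.level_le_step hs v hv
    rw [(hs w).level_eq h' hw]
    exact hlevel.trans (Nat.le_succ _)
  · rw [(hs v).eq_of_center_ne_zero h, (hs w).eq_of_center_ne_zero h']
    exact hI.level_le_adj v w hadj h h'

theorem step (hI : FloodInvariant G ident start t m)
    (hs : ∀ v, FloodStep G ident start t m v (m' v)) :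
    FloodInvariant G ident start (t + 1) m' :=
  ⟨hI.level_le_step hs, hI.exists_walk_step hs, hI.parent_step hs, fresh_step hs,
    hI.level_le_start_step hs, hI.level_le_adj_step hs⟩

end FloodInvariant

/-- The forest `F` is an outcome of flooding `G` with the given start times: its trees are the
clusters. The center `u` of the cluster of `v` minimizes `start u + dist u v` up to the choice among
ties, which is expressed by the last two fields. -/
structure IsClustering (G : SimpleGraph V) (ident start : V → ℕ) {L : ℕ}
    (F : RootedForest V L) : Prop where
  adj_parent : ∀ {v w}, F.parent v = some w → G.Adj v w
  exists_walk : ∀ v, ∃ (u : V) (q : G.Walk u v),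
    F.center v = ident u + 1 ∧ start u + 1 + q.length ≤ F.level v
  level_le_walk : ∀ {u v} (q : G.Walk u v), F.level v ≤ start u + 1 + q.length

namespace FloodInvariant

variable {G : SimpleGraph V} {ident start : V → ℕ} {L : ℕ} {m : V → FloodRecord}

theorem center_ne_zero (hI : FloodInvariant G ident start L m) (hstart : ∀ v, start v < L) (v : V) :
    (m v).center ≠ 0 :=
  fun h => (hstart v).not_ge (hI.fresh v h).1

theorem level_le_walk (hI : FloodInvariant G ident start L m) (hstart : ∀ v, start v < L) {u v : V}
    (q : G.Walk u v) : (m v).level ≤ start u + 1 + q.length := by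
  have hc := hI.center_ne_zero hstart
  induction q using SimpleGraph.Walk.concatRec with
  | Hnil => exact hI.level_le_start _ (hc _)
  | Hconcat q h ih =>
    have hlevel := hI.level_le_adj _ _ h.symm (hc _) (hc _)
    rw [SimpleGraph.Walk.length_concat]
    omega

theorem exists_isClustering (hid : Function.Injective ident)
    (hI : FloodInvariant G ident start L m) (hstart : ∀ v, start v < L) :
    ∃ F : RootedForest V L, IsClustering G ident start F ∧
      ∀ v, (m v).center = F.center v ∧
        (m v).parent = (F.parent v).elim 0 fun w => ident w + 1 := by
  have hc := hI.center_ne_zero hstart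
  have hparent (v : V) : ∃ o : Option V, (m v).parent = o.elim 0 (fun w => ident w + 1) ∧
      (o = none → (m v).center = ident v + 1) ∧
      ∀ w, o = some w → G.Adj v w ∧ (m w).center = (m v).center ∧
        (m w).level + 1 = (m v).level := by
    rcases hI.parent v (hc v) with ⟨hp, hcenter⟩ | ⟨w, hadj, hp, hw⟩
    · exact ⟨none, hp, fun _ => hcenter, by rintro w ⟨⟩⟩
    · exact ⟨some w, hp, by rintro ⟨⟩, by rintro w ⟨⟩; exact ⟨hadj, hw⟩⟩
  choose parent hcode hroot hsome using hparent
  let F : RootedForest V L :=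
    { center v := (m v).center
      parent
      level v := (m v).level
      center_parent h := (hsome _ _ h).2.1
      level_parent h := (hsome _ _ h).2.2
      root_unique {v w} hv hw h := by
        rw [hroot v hv, hroot w hw] at h
        exact hid (Nat.succ_injective h)
      level_le v := hI.level_le v (hc v) }
  exact ⟨F, ⟨fun h => (hsome _ _ h).1, fun v => hI.exists_walk v (hc v),
    hI.level_le_walk hstart⟩, fun v => ⟨rfl, hcode v⟩⟩

end FloodInvariant

/-- The distance from `u` to `v`, or the junk value `K` if `u` and `v` are not connected. -/
noncomputable def cappedDist (G : SimpleGraph V) (K : ℕ) (v u : V) : ℕ :=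
  open Classical in if G.Reachable u v then G.dist u v else K

theorem cappedDist_le_length {G : SimpleGraph V} {K : ℕ} {u v : V} (q : G.Walk u v) :
    cappedDist G K v u ≤ q.length := by
  rw [cappedDist, if_pos q.reachable]
  exact SimpleGraph.dist_le q

theorem cappedDist_self (G : SimpleGraph V) (K : ℕ) (v : V) : cappedDist G K v v = 0 :=
  Nat.le_zero.1 (cappedDist_le_length .nil)

namespace IsClustering

variable {G : SimpleGraph V} {ident start : V → ℕ} {L : ℕ} {F : RootedForest V L}

theorem one_le_level (hC : IsClustering G ident start F) (v : V) : 1 ≤ F.level v := by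
  obtain ⟨u, q, -, hq⟩ := hC.exists_walk v
  omega

theorem center_eq_of_forall_walk (hC : IsClustering G ident start F) {u v : V} (q : G.Walk u v)
    (hq : ∀ u' ≠ u, ∀ q' : G.Walk u' v, start u + q.length < start u' + q'.length) :
    F.center v = ident u + 1 := by
  obtain ⟨u', q', hcenter, hlevel⟩ := hC.exists_walk v
  by_cases hne : u' = u
  · rw [hcenter, hne]
  · have hlt := hq u' hne q'
    have hle := hC.level_le_walk q
    omega

theorem center_eq_of_hasGap {K : ℕ} {y : V → ℕ} (hy : ∀ v, y v ≤ K)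
    (hC : IsClustering G ident (fun v => K - y v) F) {v w : V} (hvw : G.Adj v w)
    (hgap : HasGap (cappedDist G K v) y) : F.center v = F.center w := by
  obtain ⟨u, hu⟩ := hgap
  have hreach : G.Reachable u v := by
    by_contra hn
    have hlt := hu v (by rintro rfl; exact hn .rfl)
    rw [cappedDist_self, cappedDist, if_neg hn] at hlt
    have := hy u
    omega
  obtain ⟨q, hq⟩ := hreach.exists_walk_length_eq_dist
  have hdist : cappedDist G K v u = q.length := by rw [cappedDist, if_pos hreach, hq]
  -- A lead of `3` at `v` is still a lead of `1` at `w`, as distances change by at most `1`.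
  have hwins (u' : V) (hne : u' ≠ u) (q' : G.Walk u' v) :
      K - y u + q.length + 3 ≤ K - y u' + q'.length := by
    have hgap := hu u' hne
    have hle := cappedDist_le_length (K := K) q'
    have := hy u
    have := hy u'
    omega
  rw [hC.center_eq_of_forall_walk q fun u' hne q' => by have := hwins u' hne q'; omega,
    hC.center_eq_of_forall_walk (q.concat hvw) fun u' hne q' => ?_]
  have hlt := hwins u' hne (q'.concat hvw.symm)
  rw [SimpleGraph.Walk.length_concat] at hlt ⊢
  omega

theorem exists_walk_root (hC : IsClustering G ident start F) {k : ℕ} {r : V}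
    (hr : F.parent r = none) (hrk : F.center r = k) (v : {u | F.center u = k}) :
    ∃ q : (G.induce {u | F.center u = k}).Walk ⟨r, hrk⟩ v, q.length ≤ F.level v := by
  obtain ⟨v, hv⟩ := v
  induction hl : F.level v using Nat.strong_induction_on generalizing v with
  | _ l ih =>
    rcases hp : F.parent v with _ | w
    · obtain rfl := F.root_unique hr hp (hrk.trans hv.symm)
      exact ⟨.nil, Nat.zero_le _⟩
    · have hlevel := F.level_parent hp
      obtain ⟨q, hq⟩ := ih (F.level w) (by omega) w ((F.center_parent hp).trans hv) rfl
      have hadj : (G.induce {u | F.center u = k}).Adj ⟨w, (F.center_parent hp).trans hv⟩ ⟨v, hv⟩ :=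
        (hC.adj_parent hp).symm
      refine ⟨q.concat hadj, ?_⟩
      rw [SimpleGraph.Walk.length_concat]
      omega

theorem ediam_le (hC : IsClustering G ident start F) (v : V) :
    (G.induce {u | F.center u = F.center v}).ediam ≤ (2 * L : ℕ) := by
  obtain ⟨r, hr, hrv, -⟩ := F.exists_root v
  have heccent : (G.induce {u | F.center u = F.center v}).eccent ⟨r, hrv⟩ ≤ L := by
    rw [SimpleGraph.eccent_le_iff]
    intro u
    obtain ⟨q, hq⟩ := hC.exists_walk_root hr hrv u
    exact (SimpleGraph.edist_le q).trans (by exact_mod_cast hq.trans (F.level_le u))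
  refine (SimpleGraph.ediam_le_two_mul_eccent ⟨r, hrv⟩).trans ?_
  push_cast
  gcongr

theorem connected_induce (hC : IsClustering G ident start F) (v : V) :
    (G.induce {u | F.center u = F.center v}).Connected :=
  have : Nonempty {u | F.center u = F.center v} := ⟨⟨v, rfl⟩⟩
  SimpleGraph.connected_of_ediam_ne_top
    (ne_top_of_le_ne_top (ENat.natCast_ne_top _) (hC.ediam_le v))

theorem diam_induce_le (hC : IsClustering G ident start F) (v : V) :
    (G.induce {u | F.center u = F.center v}).diam ≤ 2 * L :=
  ENat.toNat_le_of_le_natCast (hC.ediam_le v)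

end IsClustering

end Flooding

/-! ### Simulating a verifier in the clusters -/

section Phases

open Finset

/-- The memory of a processor that clusters the network and simulates a verifier with states `σ` in
its cluster: its own ID, the IDs of its neighbours and its start time; the size of its subtree in
the cluster tree and the inbox with the sizes reported by the children; its label in the cluster
and the size of the cluster; the inbox with the centers and labels of the neighbours; the state of
the simulated verifier. -/
structure Node (σ : Type*) extends FloodRecord where
  own : ℕ
  nbrs : Finset ℕ
  start : ℕ
  size : ℕ
  kids : ℕ → ℕ
  label : ℕ
  total : ℕ
  info : ℕ → ℕ
  inner : σ

variable {σ V : Type*}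

open Classical in
/-- The flooding round from time `t` to `t + 1`, for a processor that receives the centers of its
neighbours. -/
noncomputable def Node.flood (x : Node σ) (t : ℕ) (inbox : ℕ → ℕ) : FloodRecord :=
  if x.center ≠ 0 then x.toFloodRecord
  else if h : ∃ i ∈ x.nbrs, inbox i ≠ 0 then ⟨inbox h.choose, h.choose + 1, t + 1⟩
  else if x.start ≤ t then ⟨x.own + 1, 0, t + 1⟩
  else x.toFloodRecord

/-- The phase that builds the clusters. -/
noncomputable def floodPhase (σ : Type*) (L : ℕ) : Protocol (Node σ) where
  rounds := L
  send _ x _ := x.center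
  update t x inbox := { x with toFloodRecord := x.flood t inbox }

/-- The phase in which every processor repeatedly reports the size of its subtree to its parent. -/
def sizePhase (σ : Type*) (L : ℕ) : Protocol (Node σ) where
  rounds := L
  send _ x i := if x.parent = i + 1 then x.size else 0
  update _ x inbox := { x with kids := inbox, size := 1 + ∑ i ∈ x.nbrs, inbox i }

/-- The phase in which the preorder labels and the size of the cluster are passed down the cluster
trees. -/
def labelPhase (σ : Type*) (L : ℕ) : Protocol (Node σ) where
  rounds := L
  send _ x i := Nat.pair (x.label + 1 + ∑ j ∈ x.nbrs with j < i, x.kids j) x.total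
  update _ x inbox :=
    { x with
      label := if x.parent = 0 then 0 else (inbox (x.parent - 1)).unpair.1
      total := if x.parent = 0 then x.size else (inbox (x.parent - 1)).unpair.2 }

/-- The round in which the processors tell their neighbours their centers and labels, and initialize
the verifier `A` on their clusters. -/
def announcePhase (A : DistAlgorithm) : Protocol (Node A.State) where
  rounds := 1
  send _ x _ := Nat.pair x.center x.label
  update _ x inbox :=
    { x with
      info := inbox
      inner := A.init x.total x.label
        ({i ∈ x.nbrs | (inbox i).unpair.1 = x.center}.image fun i => (inbox i).unpair.2)
        fun _ => false }

/-- The inbox of the simulated verifier: messages from other clusters are dropped, and the others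
are indexed by the label of the sender. -/
def Node.translate (x : Node σ) (inbox : ℕ → ℕ) (j : ℕ) : ℕ :=
  ∑ i ∈ x.nbrs with x.info i = Nat.pair x.center j, inbox i

/-- The phase that simulates `R` rounds of the verifier `A`. -/
def simulatePhase (A : DistAlgorithm) (R : ℕ) : Protocol (Node A.State) where
  rounds := R
  send _ x i :=
    if (x.info i).unpair.1 = x.center then A.message x.inner (x.info i).unpair.2 else 0
  update _ x inbox :=
    { x with
      inner := if (A.output x.inner).isSome then x.inner else A.step x.inner (x.translate inbox) }

/-- Messages of `w` bits can transmit a pair of numbers up to `N`, where `N` bounds the IDs and the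
number of processors. -/
structure Fits [Fintype V] (ident : V → ℕ) (N w : ℕ) : Prop where
  ident_lt : ∀ v, ident v < N
  card_le : Fintype.card V ≤ N
  size_pair_le : ∀ a ≤ N, ∀ b ≤ N, (Nat.pair a b).size ≤ w

theorem Fits.size_le [Fintype V] {ident : V → ℕ} {N w : ℕ} (h : Fits ident N w) {a : ℕ}
    (ha : a ≤ N) : a.size ≤ w :=
  (Nat.size_le_size (Nat.left_le_pair a 0)).trans (h.size_pair_le a ha 0 (Nat.zero_le N))

variable {G : SimpleGraph V} {ident : V → ℕ} {N w : ℕ} {x : V → Node σ}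

/-! #### Flooding -/

/-- Every processor knows its own ID and those of its neighbours. -/
structure KnowsNeighbors (G : SimpleGraph V) (ident : V → ℕ) (x : V → Node σ) : Prop where
  own : ∀ v, (x v).own = ident v
  mem_nbrs : ∀ v i, i ∈ (x v).nbrs ↔ ∃ u, G.Adj v u ∧ ident u = i

theorem KnowsNeighbors.run_floodPhase (hx : KnowsNeighbors G ident x) (L t : ℕ) :
    KnowsNeighbors G ident ((floodPhase σ L).run w G ident x t) := by
  induction t with
  | zero => exact hx
  | succ t ih => exact ⟨ih.own, ih.mem_nbrs⟩

theorem start_run_floodPhase (L t : ℕ) (v : V) :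
    ((floodPhase σ L).run w G ident x t v).start = (x v).start := by
  induction t with
  | zero => rfl
  | succ _ ih => exact ih

theorem KnowsNeighbors.floodStep (hx : KnowsNeighbors G ident x) (t : ℕ) (v : V) {inbox : ℕ → ℕ}
    (hinbox : ∀ u, G.Adj v u → inbox (ident u) = (x u).center) :
    FloodStep G ident (fun v => (x v).start) t (fun v => (x v).toFloodRecord) v
      ((x v).flood t inbox) := by
  unfold Node.flood
  split_ifs with hv hex ht
  · exact .keep hv
  · obtain ⟨hmem, hne⟩ := hex.choose_spec
    obtain ⟨u, hadj, hu⟩ := (hx.mem_nbrs v _).1 hmem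
    rw [← hu, hinbox u hadj] at hne ⊢
    exact .join (not_not.1 hv) hadj hne
  all_goals
    have hnbr (u : V) (hadj : G.Adj v u) : (x u).center = 0 := by
      by_contra hne
      exact hex ⟨ident u, (hx.mem_nbrs v _).2 ⟨u, hadj, rfl⟩, hinbox u hadj ▸ hne⟩
  · rw [hx.own v]
    exact .found (not_not.1 hv) hnbr ht
  · exact .wait (not_not.1 hv) hnbr (not_le.1 ht)

/-- Every processor also knows the center of its cluster and its parent in the cluster tree. -/
structure KnowsForest (G : SimpleGraph V) (ident : V → ℕ) {L : ℕ} (F : RootedForest V L)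
    (x : V → Node σ) : Prop extends KnowsNeighbors G ident x where
  center : ∀ v, (x v).center = F.center v
  parent : ∀ v, (x v).parent = (F.parent v).elim 0 fun w => ident w + 1

variable {L : ℕ} {F : RootedForest V L}

theorem KnowsForest.parent_eq_iff (hid : Function.Injective ident) (hx : KnowsForest G ident F x)
    (u v : V) : (x u).parent = ident v + 1 ↔ F.parent u = some v := by
  rw [hx.parent u]
  rcases F.parent u with _ | w
  · simp
  · simp [hid.eq_iff]

theorem KnowsForest.run_sizePhase (hx : KnowsForest G ident F x) (t : ℕ) :
    KnowsForest G ident F ((sizePhase σ L).run w G ident x t) := by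
  induction t with
  | zero => exact hx
  | succ t ih => exact ⟨⟨ih.own, ih.mem_nbrs⟩, ih.center, ih.parent⟩

variable [Fintype V]

theorem KnowsNeighbors.floodInvariant_run (hid : Function.Injective ident) (hfits : Fits ident N w)
    (hx : KnowsNeighbors G ident x) (hcenter : ∀ v, (x v).center = 0) (L t : ℕ) :
    FloodInvariant G ident (fun v => (x v).start) t
      fun v => ((floodPhase σ L).run w G ident x t v).toFloodRecord := by
  induction t with
  | zero => exact .of_center_eq_zero hcenter
  | succ t ih =>
    refine ih.step fun v => ?_
    have hsize (u : V) : ((floodPhase σ L).run w G ident x t u).center.size ≤ w := by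
      by_cases hu : ((floodPhase σ L).run w G ident x t u).center = 0
      · rw [hu]
        exact hfits.size_le (Nat.zero_le N)
      · obtain ⟨c, -, hc, -⟩ := ih.exists_walk u hu
        rw [hc]
        exact hfits.size_le (hfits.ident_lt c)
    have hstep := (hx.run_floodPhase (w := w) L t).floodStep t v
      fun u hadj => deliver_ident hid hadj rfl (hsize u)
    simp only [start_run_floodPhase] at hstep
    exact hstep

theorem KnowsNeighbors.exists_knowsForest (hid : Function.Injective ident)
    (hfits : Fits ident N w) (hx : KnowsNeighbors G ident x) (hcenter : ∀ v, (x v).center = 0)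
    (hstart : ∀ v, (x v).start < L) :
    ∃ F : RootedForest V L, IsClustering G ident (fun v => (x v).start) F ∧
      KnowsForest G ident F ((floodPhase σ L).result w G ident x) := by
  obtain ⟨F, hF, hrecord⟩ :=
    (hx.floodInvariant_run hid hfits hcenter L L).exists_isClustering hid hstart
  exact ⟨F, hF, hx.run_floodPhase L L, fun v => (hrecord v).1, fun v => (hrecord v).2⟩

/-! #### Subtree sizes -/

variable [DecidableEq V]

theorem KnowsForest.sum_nbrs (hid : Function.Injective ident)
    (hF : ∀ {v w}, F.parent v = some w → G.Adj v w) (hx : KnowsForest G ident F x) (v : V)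
    {f : ℕ → ℕ} {g : V → ℕ}
    (hfg : ∀ u, G.Adj v u → f (ident u) = if F.parent u = some v then g u else 0) :
    ∑ i ∈ (x v).nbrs, f i = ∑ u with F.parent u = some v, g u := by
  classical
  have hnbrs : (x v).nbrs = ({u | G.Adj v u} : Finset V).image ident := by
    ext i
    simp [hx.mem_nbrs]
  rw [hnbrs, sum_image hid.injOn, sum_congr rfl fun u hu => hfg u (mem_filter_univ u |>.1 hu),
    ← sum_filter, filter_filter]
  congr 1
  ext u
  simpa using fun hu => (hF hu).symm

theorem KnowsForest.deliver_size (hid : Function.Injective ident) (hfits : Fits ident N w)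
    (hx : KnowsForest G ident F x) {u v : V} (hadj : G.Adj v u) (t : ℕ)
    (hsize : F.parent u = some v → (x u).size = F.size u) :
    deliver w G ident v (fun u => (sizePhase σ L).send t (x u) (ident v)) (ident u) =
      if F.parent u = some v then F.size u else 0 := by
  have hsend : (sizePhase σ L).send t (x u) (ident v) =
      if F.parent u = some v then F.size u else 0 := by
    simp only [sizePhase, hx.parent_eq_iff hid]
    split_ifs with h
    · exact hsize h
    · rfl
  have hle := F.label_add_size_le_card ident u
  have hcard := hfits.card_le
  exact deliver_ident hid hadj hsend (hfits.size_le (by split_ifs <;> omega))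

theorem KnowsForest.size_run_sizePhase (hid : Function.Injective ident) (hfits : Fits ident N w)
    (hF : ∀ {v w}, F.parent v = some w → G.Adj v w) (hx : KnowsForest G ident F x) {t : ℕ} {v : V}
    (ht : L + 1 ≤ t + F.level v) : ((sizePhase σ L).run w G ident x t v).size = F.size v := by
  induction t generalizing v with
  | zero => have := F.level_le v; omega
  | succ t ih =>
    rw [F.size_eq v]
    refine congrArg (1 + ·) ((hx.run_sizePhase t).sum_nbrs hid hF v fun u hadj =>
      (hx.run_sizePhase t).deliver_size hid hfits hadj t fun hp => ih ?_)
    have := F.level_parent hp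
    omega

/-- Every processor also knows the size of its subtree and the sizes of the subtrees of its
children. -/
structure KnowsSizes (G : SimpleGraph V) (ident : V → ℕ) {L : ℕ} (F : RootedForest V L)
    (x : V → Node σ) : Prop extends KnowsForest G ident F x where
  size : ∀ v, (x v).size = F.size v
  kids : ∀ v u, G.Adj v u →
    (x v).kids (ident u) = if F.parent u = some v then F.size u else 0

theorem KnowsForest.result_sizePhase (hid : Function.Injective ident) (hfits : Fits ident N w)
    {start : V → ℕ} (hF : IsClustering G ident start F) (hx : KnowsForest G ident F x) :
    KnowsSizes G ident F ((sizePhase σ L).result w G ident x) where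
  toKnowsForest := hx.run_sizePhase L
  size v := hx.size_run_sizePhase hid hfits hF.adj_parent (by
    have := hF.one_le_level v
    simp only [sizePhase]
    omega)
  kids v u hadj := by
    obtain ⟨t, rfl⟩ : ∃ t, L = t + 1 :=
      Nat.exists_eq_add_of_le' ((hF.one_le_level v).trans (F.level_le v))
    refine (hx.run_sizePhase t).deliver_size hid hfits hadj t fun hp =>
      hx.size_run_sizePhase hid hfits hF.adj_parent ?_
    have := hF.one_le_level v
    have := F.level_parent hp
    omega

/-! #### Preorder labels -/

theorem KnowsSizes.run_labelPhase (hx : KnowsSizes G ident F x) (t : ℕ) :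
    KnowsSizes G ident F ((labelPhase σ L).run w G ident x t) := by
  induction t with
  | zero => exact hx
  | succ t ih => exact ⟨⟨⟨ih.own, ih.mem_nbrs⟩, ih.center, ih.parent⟩, ih.size, ih.kids⟩

theorem KnowsSizes.send_labelPhase (hid : Function.Injective ident)
    (hF : ∀ {v w}, F.parent v = some w → G.Adj v w) (hx : KnowsSizes G ident F x) (t : ℕ) {u v : V}
    (hp : F.parent u = some v) (hlabel : (x v).label = F.label ident v) :
    (labelPhase σ L).send t (x v) (ident u) = Nat.pair (F.label ident u) (x v).total := by
  have hsum : ∑ j ∈ (x v).nbrs with j < ident u, (x v).kids j =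
      ∑ y with F.parent y = some v ∧ ident y < ident u, F.size y := by
    rw [sum_filter, ← filter_filter, sum_filter]
    refine hx.sum_nbrs hid hF v fun y hy => ?_
    rw [hx.kids v y hy]
    split_ifs <;> rfl
  rw [F.label_of_parent_eq_some ident hp, ← hsum, ← hlabel]
  rfl

theorem KnowsSizes.label_run_labelPhase (hid : Function.Injective ident) (hfits : Fits ident N w)
    {start : V → ℕ} (hF : IsClustering G ident start F) (hx : KnowsSizes G ident F x) {t : ℕ}
    {v : V} (ht : F.level v ≤ t) :
    ((labelPhase σ L).run w G ident x t v).label = F.label ident v ∧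
      ((labelPhase σ L).run w G ident x t v).total = #{u | F.center u = F.center v} := by
  induction t generalizing v with
  | zero => have := hF.one_le_level v; omega
  | succ t ih =>
    have hxt := hx.run_labelPhase (w := w) t
    have hparent := hxt.parent v
    rcases hp : F.parent v with _ | p <;> rw [hp] at hparent
    · exact ⟨(if_pos hparent).trans (F.label_of_parent_eq_none ident hp).symm,
        (if_pos hparent).trans ((hxt.size v).trans (F.size_root hp))⟩
    · obtain ⟨hlabel, htotal⟩ := ih (v := p) (by have := F.level_parent hp; omega)
      have hsend := hxt.send_labelPhase hid hF.adj_parent t hp hlabel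
      rw [htotal, F.center_parent hp] at hsend
      have hinbox : deliver w G ident v (fun u => (labelPhase σ L).send t
          ((labelPhase σ L).run w G ident x t u) (ident v))
          (((labelPhase σ L).run w G ident x t v).parent - 1) =
            Nat.pair (F.label ident v) #{u | F.center u = F.center v} := by
        rw [hparent]
        have hle := F.label_add_size_le_card ident v
        have hcard := hfits.card_le
        exact deliver_ident hid (hF.adj_parent hp) hsend
          (hfits.size_pair_le _ (by omega) _ ((card_le_univ _).trans hcard))
      have hne := hparent.trans_ne (Nat.succ_ne_zero (ident p))
      exact ⟨(if_neg hne).trans (by rw [hinbox, Nat.unpair_pair]),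
        (if_neg hne).trans (by rw [hinbox, Nat.unpair_pair])⟩

/-- Every processor also knows its label in the cluster and the size of the cluster. -/
structure KnowsLabels (G : SimpleGraph V) (ident : V → ℕ) {L : ℕ} (F : RootedForest V L)
    (x : V → Node σ) : Prop extends KnowsForest G ident F x where
  label : ∀ v, (x v).label = F.label ident v
  total : ∀ v, (x v).total = #{u | F.center u = F.center v}

theorem KnowsSizes.result_labelPhase (hid : Function.Injective ident) (hfits : Fits ident N w)
    {start : V → ℕ} (hF : IsClustering G ident start F) (hx : KnowsSizes G ident F x) :
    KnowsLabels G ident F ((labelPhase σ L).result w G ident x) where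
  toKnowsForest := (hx.run_labelPhase L).toKnowsForest
  label v := (hx.label_run_labelPhase hid hfits hF (F.level_le v)).1
  total v := (hx.label_run_labelPhase hid hfits hF (F.level_le v)).2

end Phases

/-! #### Simulation -/

section Simulation

open Finset

variable {A : DistAlgorithm} {V : Type} {G : SimpleGraph V} {ident : V → ℕ} {N w L : ℕ}
  {F : RootedForest V L} {x : V → Node A.State}

theorem KnowsForest.image_labels {σ : Type*} {x : V → Node σ} (hx : KnowsForest G ident F x)
    {k : ℕ} (v : {u | F.center u = k}) {_ : Fintype ((G.induce {u | F.center u = k}).neighborSet v)}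
    {inbox : ℕ → ℕ} {ℓ : V → ℕ}
    (hinbox : ∀ u, G.Adj v u → inbox (ident u) = Nat.pair (F.center u) (ℓ u)) :
    ({i ∈ (x v).nbrs | (inbox i).unpair.1 = (x v).center}.image fun i => (inbox i).unpair.2) =
      ((G.induce {u | F.center u = k}).neighborFinset v).image fun u => ℓ u.1 := by
  ext j
  simp only [mem_image, mem_filter, hx.mem_nbrs, SimpleGraph.mem_neighborFinset, hx.center]
  constructor
  · rintro ⟨_, ⟨⟨u, hu, rfl⟩, hc⟩, rfl⟩
    rw [hinbox u hu, Nat.unpair_pair] at hc ⊢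
    exact ⟨⟨u, hc.trans v.2⟩, hu, rfl⟩
  · rintro ⟨⟨u, hc⟩, hu : G.Adj v u, rfl⟩
    refine ⟨ident u, ⟨⟨u, hu, rfl⟩, ?_⟩, ?_⟩ <;> rw [hinbox u hu, Nat.unpair_pair]
    exact hc.trans v.2.symm

variable [Fintype V] [DecidableEq V]

/-- Every processor knows its cluster and the labels of its neighbours, and `t` rounds of the
verifier `A` on its cluster, with the preorder labels as IDs, have been simulated. -/
structure Simulates (A : DistAlgorithm) (G : SimpleGraph V) (ident : V → ℕ) (F : RootedForest V L)
    (t : ℕ) (x : V → Node A.State) : Prop extends KnowsForest G ident F x where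
  info : ∀ v u, G.Adj v u → (x v).info (ident u) = Nat.pair (F.center u) (F.label ident u)
  inner : ∀ k (v : {u | F.center u = k}), (x v).inner =
    A.stateAt (G.induce {u | F.center u = k}) (fun u => F.label ident u) (fun _ _ => false) t v

theorem KnowsLabels.result_announcePhase (hid : Function.Injective ident)
    (hfits : Fits ident N w) {start : V → ℕ} (hF : IsClustering G ident start F)
    (hx : KnowsLabels G ident F x) :
    Simulates A G ident F 0 ((announcePhase A).result w G ident x) := by
  have hinbox (v u : V) (hadj : G.Adj v u) :
      deliver w G ident v (fun u => (announcePhase A).send 0 (x u) (ident v)) (ident u) =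
        Nat.pair (F.center u) (F.label ident u) := by
    refine deliver_ident hid hadj (congrArg₂ Nat.pair (hx.center u) (hx.label u))
      (hfits.size_pair_le _ ?_ _ ?_)
    · obtain ⟨c, -, hc, -⟩ := hF.exists_walk u
      rw [hc]
      exact hfits.ident_lt c
    · have := F.label_add_size_le_card ident u
      have := hfits.card_le
      omega
  refine ⟨⟨⟨hx.own, hx.mem_nbrs⟩, hx.center, hx.parent⟩, hinbox, fun k v => ?_⟩
  have htotal : (x v).total = Fintype.card {u | F.center u = k} := by
    rw [hx.total v, show F.center v = k from v.2]
    exact (Fintype.card_subtype _).symm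
  rw [DistAlgorithm.stateAt, ← hx.image_labels v (hinbox v), ← htotal, ← hx.label v]
  rfl

theorem Simulates.mem_nbrs_and_info_iff {t : ℕ} (hx : Simulates A G ident F t x) {k : ℕ}
    (v : {u | F.center u = k}) (i j : ℕ) :
    i ∈ (x v).nbrs ∧ (x v).info i = Nat.pair (x v).center j ↔
      ∃ u : (G.induce {u | F.center u = k}).neighborSet v,
        ident u = i ∧ F.label ident u = j := by
  rw [hx.mem_nbrs, hx.center]
  constructor
  · rintro ⟨⟨u, hu, rfl⟩, h⟩
    rw [hx.info v u hu, Nat.pair_eq_pair] at h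
    exact ⟨⟨⟨u, h.1.trans v.2⟩, hu⟩, rfl, h.2⟩
  · rintro ⟨⟨⟨u, hc⟩, hu : G.Adj v u⟩, rfl, rfl⟩
    refine ⟨⟨u, hu, rfl⟩, ?_⟩
    rw [hx.info v u hu, Nat.pair_eq_pair]
    exact ⟨hc.trans v.2.symm, rfl⟩

theorem Simulates.translate_eq_extend (hid : Function.Injective ident) {t : ℕ}
    (hx : Simulates A G ident F t x) {k : ℕ} (v : {u | F.center u = k}) {inbox : ℕ → ℕ}
    {m : {u | F.center u = k} → ℕ}
    (hinbox : ∀ u : {u | F.center u = k}, G.Adj v u → inbox (ident u) = m u) :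
    (x v).translate inbox =
      Function.extend
        (fun u : (G.induce {u | F.center u = k}).neighborSet v => F.label ident u)
        (fun u => m u) fun _ => 0 := by
  have hinj : Function.Injective
      fun u : (G.induce {u | F.center u = k}).neighborSet v => F.label ident u := fun _ _ h =>
    Subtype.ext (F.injective_label hid k h)
  funext j
  by_cases hj : ∃ u : (G.induce {u | F.center u = k}).neighborSet v, F.label ident u = j
  · obtain ⟨u, rfl⟩ := hj
    have hfilter : {i ∈ (x v).nbrs | (x v).info i = Nat.pair (x v).center (F.label ident u)} =
        {ident u} := by
      ext i
      rw [mem_filter, hx.mem_nbrs_and_info_iff, mem_singleton]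
      exact ⟨fun ⟨u', hi, h⟩ => by rw [← hi, hinj h], fun h => ⟨u, h.symm, rfl⟩⟩
    rw [hinj.extend_apply (f := fun u : (G.induce {u | F.center u = k}).neighborSet v =>
      F.label ident u), ← hinbox u u.2, Node.translate, hfilter, sum_singleton]
  · rw [Function.extend_apply' _ _ _ hj, Node.translate]
    refine sum_eq_zero fun i hi => absurd ?_ hj
    obtain ⟨u, -, hu⟩ := (hx.mem_nbrs_and_info_iff v i j).1 (mem_filter.1 hi)
    exact ⟨u, hu⟩

theorem Simulates.send_simulatePhase {t : ℕ} (hx : Simulates A G ident F t x) (R s : ℕ) {k : ℕ}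
    {u v : {u | F.center u = k}} (hadj : G.Adj u v) :
    (simulatePhase A R).send s (x u) (ident v) =
      A.message
        (A.stateAt (G.induce {u | F.center u = k}) (fun u => F.label ident u) (fun _ _ => false) t
          u)
        (F.label ident v) := by
  have hcenter : F.center v = F.center u := v.2.trans u.2.symm
  simp only [simulatePhase, hx.info u v hadj, Nat.unpair_pair, hx.center, hcenter, if_true,
    hx.inner k u]

theorem Simulates.run_simulatePhase (hid : Function.Injective ident) {B : ℕ}
    (hB : ∀ k, A.RespectsBandwidth B (G.induce {u | F.center u = k}) fun u => F.label ident u)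
    (hw : B * Nat.clog 2 (Fintype.card V) ≤ w) (hx : Simulates A G ident F 0 x) (R t : ℕ) :
    Simulates A G ident F t ((simulatePhase A R).run w G ident x t) := by
  induction t with
  | zero => exact hx
  | succ t ih =>
    refine ⟨⟨⟨ih.own, ih.mem_nbrs⟩, ih.center, ih.parent⟩, ih.info, fun k v => ?_⟩
    rw [DistAlgorithm.stateAt, ← ih.inner k v]
    refine if_congr Iff.rfl rfl (congrArg _ (ih.translate_eq_extend hid v
      (m := fun u => A.message (A.stateAt _ _ _ t u) _) fun u hadj => ?_))
    exact deliver_ident hid hadj (ih.send_simulatePhase R t hadj.symm)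
      (((hB k (fun _ _ => false) t u v hadj.symm).trans
        (Nat.mul_le_mul_left B (Nat.clog_mono_right 2 (Fintype.card_subtype_le _)))).trans hw)

/-- The phases that build the clusters and let every processor start the verifier `A` on its
cluster. -/
noncomputable def clusterPhase (A : DistAlgorithm) (L : ℕ) : Protocol (Node A.State) :=
  (floodPhase A.State L).andThen <| (sizePhase A.State L).andThen <|
    (labelPhase A.State L).andThen <| announcePhase A

theorem KnowsNeighbors.exists_simulates (hid : Function.Injective ident) (hfits : Fits ident N w)
    (hx : KnowsNeighbors G ident x) (hcenter : ∀ v, (x v).center = 0)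
    (hstart : ∀ v, (x v).start < L) :
    ∃ F : RootedForest V L, IsClustering G ident (fun v => (x v).start) F ∧
      Simulates A G ident F 0 ((clusterPhase A L).result w G ident x) := by
  obtain ⟨F, hF, hforest⟩ := hx.exists_knowsForest hid hfits hcenter hstart
  have hsizes := hforest.result_sizePhase hid hfits hF
  have hlabels := hsizes.result_labelPhase hid hfits hF
  refine ⟨F, hF, ?_⟩
  simp only [clusterPhase, Protocol.result_andThen]
  exact hlabels.result_announcePhase hid hfits hF

end Simulation

/-! ### Graph properties and clusters -/

section WithinClusters

variable {V α : Type*}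

/-- The graph that remains when the edges between different fibers of `c` are removed. -/
def withinClusters (G : SimpleGraph V) (c : V → α) : SimpleGraph V :=
  G \ (⊤ : SimpleGraph α).comap c

theorem withinClusters_adj {G : SimpleGraph V} {c : V → α} {u v : V} :
    (withinClusters G c).Adj u v ↔ G.Adj u v ∧ c u = c v := by
  simp [withinClusters]

theorem withinClusters_of_injective (G : SimpleGraph V) {c : V → α} (hc : Function.Injective c) :
    withinClusters G c = ⊥ := by
  ext u v
  rw [withinClusters_adj, hc.eq_iff, SimpleGraph.bot_adj, iff_false]
  exact fun h => G.ne_of_adj h.1 h.2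

theorem symmDiff_edgeSet_withinClusters (G : SimpleGraph V) (c : V → α) :
    symmDiff G.edgeSet (withinClusters G c).edgeSet =
      (G ⊓ (⊤ : SimpleGraph α).comap c).edgeSet := by
  rw [withinClusters, SimpleGraph.edgeSet_sdiff, SimpleGraph.edgeSet_inf, Set.symmDiff_def,
    Set.sdiff_sdiff_right_self, Set.sdiff_eq_empty.2 Set.sdiff_subset, Set.union_empty]

end WithinClusters

namespace GraphProperty

variable {P : GraphProperty} {V : Type} [Finite V] {G : SimpleGraph V}

theorem NonDisjointed.holds_induce (hnd : P.NonDisjointed) (h : P.Holds G) {U : Set V}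
    (hU : U.Nonempty) : P.Holds (G.induce U) := by
  by_contra hn
  have := hU.to_subtype
  obtain ⟨U', -, hw⟩ := hnd.exists_witness U (G.induce U) hn
  exact hw V G ⟨(SimpleGraph.Embedding.induce U).comp (SimpleGraph.Embedding.induce U')⟩ h

theorem NonDisjointed.exists_not_holds_induce {α : Type*} (hnd : P.NonDisjointed) [Nonempty V]
    (c : V → α) (h : ¬ P.Holds (withinClusters G c)) :
    ∃ v, ¬ P.Holds (G.induce {u | c u = c v}) := by
  obtain ⟨U, hU, hw⟩ := hnd.exists_witness V _ h
  obtain ⟨U', -, hconn, hw'⟩ := hnd.connected_witness V _ U hU hw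
  obtain ⟨v⟩ := hconn.nonempty
  have hc (u : U') : c u = c v := by
    obtain ⟨q⟩ := hconn.preconnected u v
    induction q with
    | nil => rfl
    | cons hadj _ ih => exact (withinClusters_adj.1 hadj).2.trans ih
  refine ⟨v, hw' _ _ ⟨⟨Set.embeddingOfSubset U' {u | c u = c v} fun u hu => hc ⟨u, hu⟩, ?_⟩⟩⟩
  intro u u'
  exact (withinClusters_adj.trans (and_iff_left ((hc u).trans (hc u').symm))).symm

theorem NonDisjointed.holds_bot (hnd : P.NonDisjointed) [Nonempty V] (h : P.Holds G) :
    P.Holds (⊥ : SimpleGraph V) := by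
  by_contra hbot
  rw [← withinClusters_of_injective G Function.injective_id] at hbot
  obtain ⟨v, hv⟩ := hnd.exists_not_holds_induce id hbot
  exact hv (hnd.holds_induce h ⟨v, rfl⟩)

theorem IsFar.not_holds_withinClusters {α : Type*} {ε : ℝ} (hfar : P.IsFar ε G) (c : V → α)
    (hlt : ((G ⊓ (⊤ : SimpleGraph α).comap c).edgeSet.ncard : ℝ) < ε * G.edgeSet.ncard) :
    ¬ P.Holds (withinClusters G c) := by
  rw [← symmDiff_edgeSet_withinClusters] at hlt
  exact fun h => (hfar.2 _ h).not_gt hlt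

theorem IsFar.ne_bot {ε : ℝ} (hfar : P.IsFar ε G) (hbot : P.Holds (⊥ : SimpleGraph V)) :
    G ≠ ⊥ := by
  rintro rfl
  exact hfar.1 hbot

theorem IsFar.le_one {ε : ℝ} (hfar : P.IsFar ε G) (hbot : P.Holds (⊥ : SimpleGraph V)) :
    ε ≤ 1 := by
  have hpos : (0 : ℝ) < G.edgeSet.ncard :=
    Nat.cast_pos.2 ((Set.ncard_pos (Set.toFinite _)).2
      (SimpleGraph.edgeSet_nonempty.2 (hfar.ne_bot hbot)))
  have hle := hfar.2 _ hbot
  rw [SimpleGraph.edgeSet_bot, ← Set.bot_eq_empty, symmDiff_bot] at hle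
  exact le_of_mul_le_mul_right (hle.trans_eq (one_mul _).symm) hpos

theorem holds_bot_fin_iff [Fintype V] :
    P.Holds (⊥ : SimpleGraph (Fin (Fintype.card V))) ↔ P.Holds (⊥ : SimpleGraph V) := by
  have e : (⊥ : SimpleGraph V) ≃g (⊥ : SimpleGraph (Fin (Fintype.card V))) :=
    ⟨Fintype.equivFin V, by simp⟩
  exact ⟨P.iso_invariant ⟨e.symm⟩, P.iso_invariant ⟨e⟩⟩

end GraphProperty

/-! ### The tester -/

section Tester

open Finset

/-- `A` verifies `P` within `r (diam G + 1)` rounds, with messages of at most `B ⌈log₂ n⌉` bits. -/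
def DistAlgorithm.Verifies (A : DistAlgorithm) (κ : ℕ) (P : GraphProperty) (B r : ℕ) : Prop :=
  ∀ (V : Type) [Fintype V] (G : SimpleGraph V) (ident : V → ℕ),
    G.Connected → IsIdAssignment κ ident →
      A.RespectsBandwidth B G ident ∧
      A.HaltsWithin (r * (G.diam + 1)) G ident ∧
      ∀ ω : A.Coins V, (∀ v, A.Outputs G ident ω v true) ↔ P.Holds G

/-- The bound on the random shifts in a network of `n` processors, when they are geometric with
parameter `2⁻ᵏ`. -/
def shiftBound (k n : ℕ) : ℕ := 2 ^ k * (Nat.clog 2 n + 3) + 3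

/-- The network sizes `n` for which the tester answers without communication, by whether the
edgeless graph has `P`. -/
def EdgelessDecides (P : GraphProperty) (ε : ℝ) (n : ℕ) : Prop :=
  n ≤ 1 ∨ 1 < ε ∨ ¬ P.Holds (⊥ : SimpleGraph (Fin n))

/-- The memory in which a processor that knows the IDs `own` and `nbrs` starts. -/
def startNode (A : DistAlgorithm) (own : ℕ) (nbrs : Finset ℕ) (start : ℕ) : Node A.State :=
  { center := 0, parent := 0, level := 0, own := own, nbrs := nbrs, start := start
    size := 0, kids := 0, label := 0, total := 0, info := 0
    inner := A.init 0 0 ∅ fun _ => false }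

open Classical in
/-- The `ε`-tester for `P` with shifts of parameter `2⁻ᵏ` and messages of at most `b ⌈log₂ n⌉` bits,
when `A` is a verifier that stops within `r (diam G + 1)` rounds. -/
noncomputable def tester (A : DistAlgorithm) (P : GraphProperty) (b r : ℕ) (ε : ℝ) (k : ℕ) :
    FixedTimeAlgorithm where
  Memory := Node A.State
  coins n := shiftBound k n * k
  init n i s ω := startNode A i s (shiftBound k n - shift k (shiftBound k n) ω)
  protocol n :=
    if EdgelessDecides P ε n then .idle _
    else (clusterPhase A (shiftBound k n + 1)).andThen
      (simulatePhase A (r * (2 * (shiftBound k n + 1) + 1)))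
  width n := b * Nat.clog 2 n
  accept n x :=
    if EdgelessDecides P ε n then decide (P.Holds (⊥ : SimpleGraph (Fin n)))
    else decide (A.output x.inner = some true)

variable {A : DistAlgorithm} {P : GraphProperty} {B r κ k b : ℕ} {ε : ℝ}

theorem protocol_tester {n : ℕ} (h : ¬ EdgelessDecides P ε n) :
    (tester A P b r ε k).protocol n = (clusterPhase A (shiftBound k n + 1)).andThen
      (simulatePhase A (r * (2 * (shiftBound k n + 1) + 1))) :=
  if_neg h

theorem accept_tester_iff {n : ℕ} (h : ¬ EdgelessDecides P ε n) (x : Node A.State) :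
    (tester A P b r ε k).accept n x = true ↔ A.output x.inner = some true := by
  simp only [tester, if_neg h, decide_eq_true_iff]

theorem accept_tester_of_edgelessDecides {n : ℕ} (h : EdgelessDecides P ε n) (x : Node A.State) :
    (tester A P b r ε k).accept n x = true ↔ P.Holds (⊥ : SimpleGraph (Fin n)) := by
  simp only [tester, if_pos h, decide_eq_true_iff]

/-! #### Round complexity -/

theorem clog_le_three_mul_log {n : ℕ} (hn : 2 ≤ n) : (Nat.clog 2 n : ℝ) ≤ 3 * Real.log n := by
  have hlog2 := Real.log_two_gt_d9
  have hlog : Real.log 2 ≤ Real.log n := Real.log_le_log two_pos (by exact_mod_cast hn)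
  obtain ⟨m, hm⟩ := Nat.exists_eq_add_of_le' (Nat.clog_pos one_lt_two hn)
  have hlt := Nat.pow_pred_clog_lt_self one_lt_two hn
  rw [hm, Nat.pred_succ] at hlt
  have hpow : m * Real.log 2 ≤ Real.log n := by
    rw [← Real.log_pow]
    exact Real.log_le_log (by positivity) (by exact_mod_cast hlt.le)
  rw [hm]
  push_cast
  nlinarith

theorem rounds_tester_le {n : ℕ} (h : ¬ EdgelessDecides P ε n) :
    ((tester A P b r ε k).protocol n).rounds ≤ 32 * (r + 1) * (2 ^ k * Nat.clog 2 n) := by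
  have hrounds : ((tester A P b r ε k).protocol n).rounds =
      shiftBound k n + 1 + (shiftBound k n + 1 + (shiftBound k n + 1 + 1)) +
        r * (2 * (shiftBound k n + 1) + 1) := congrArg Protocol.rounds (protocol_tester h)
  have hclog : 1 ≤ Nat.clog 2 n := Nat.clog_pos one_lt_two (not_le.1 fun hn => h (.inl hn))
  have hbound : shiftBound k n + 1 ≤ 8 * (2 ^ k * Nat.clog 2 n) := by
    have := Nat.one_le_two_pow (n := k)
    rw [shiftBound]
    nlinarith
  have hr := Nat.mul_le_mul_left r hbound
  rw [hrounds]
  linarith [Nat.le_mul_of_pos_right r (Nat.succ_pos (shiftBound k n))]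

theorem rounds_tester_le_log (hε : 0 < ε) (hk : ε ≤ 1 → ε * 2 ^ k ≤ 72) (n : ℕ) :
    (((tester A P b r ε k).protocol n).rounds : ℝ) ≤ 6912 * (r + 1) * Real.log n / ε := by
  by_cases h : EdgelessDecides P ε n
  · have hrounds : ((tester A P b r ε k).protocol n).rounds = 0 := by
      simp only [tester, if_pos h]
      rfl
    rw [hrounds, Nat.cast_zero]
    positivity
  obtain ⟨hn, hε1, -⟩ : ¬ n ≤ 1 ∧ ¬ 1 < ε ∧ _ := by simpa only [EdgelessDecides, not_or] using h
  rw [le_div_iff₀ hε]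
  calc (((tester A P b r ε k).protocol n).rounds : ℝ) * ε
      ≤ (32 * (r + 1) * (2 ^ k * Nat.clog 2 n)) * ε := by
        gcongr
        exact_mod_cast rounds_tester_le h
    _ = 32 * (r + 1) * (ε * 2 ^ k) * Nat.clog 2 n := by ring
    _ ≤ 32 * (r + 1) * 72 * (3 * Real.log n) := by
        gcongr
        · exact hk (not_lt.1 hε1)
        · exact clog_le_three_mul_log (not_le.1 hn)
    _ = 6912 * (r + 1) * Real.log n := by ring

/-! #### The verdicts in a cluster -/

variable {V : Type} [Fintype V] {G : SimpleGraph V} {ident : V → ℕ}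

theorem IsIdAssignment.fits (hκ : 1 ≤ κ) (hid : IsIdAssignment κ ident)
    (hn : 2 ≤ Fintype.card V) (hb : 2 * κ + 2 ≤ b) :
    Fits ident (Fintype.card V ^ κ) (b * Nat.clog 2 (Fintype.card V)) where
  ident_lt := hid.2
  card_le := Nat.le_self_pow (Nat.one_le_iff_ne_zero.1 hκ) _
  size_pair_le a ha m hm := by
    set n := Fintype.card V
    refine (size_le_mul_clog ?_).trans (Nat.mul_le_mul_right _ hb)
    calc Nat.pair a m < (max a m + 1) ^ 2 := Nat.pair_lt_max_add_one_sq a m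
      _ ≤ (n ^ κ + 1) ^ 2 := by gcongr; exact max_le ha hm
      _ ≤ (n ^ κ * n) ^ 2 := by
        have := Nat.one_le_pow κ n (by omega)
        gcongr
        nlinarith
      _ = n ^ (2 * κ + 2) := by rw [← pow_succ, ← pow_mul]; ring

theorem outputs_tester_iff (h : ¬ EdgelessDecides P ε (Fintype.card V))
    (ω : (tester A P b r ε k).toAlgorithm.Coins V) (v : V) :
    (tester A P b r ε k).toAlgorithm.Outputs G ident ω v true ↔
      A.output ((simulatePhase A (r * (2 * (shiftBound k (Fintype.card V) + 1) + 1))).result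
        (b * Nat.clog 2 (Fintype.card V)) G ident
        ((clusterPhase A (shiftBound k (Fintype.card V) + 1)).result
          (b * Nat.clog 2 (Fintype.card V)) G ident ((tester A P b r ε k).initial G ident ω))
        v).inner = some true := by
  have hfinal := (congrArg (fun Q => Protocol.result Q (b * Nat.clog 2 (Fintype.card V)) G ident
    ((tester A P b r ε k).initial G ident ω) v) (protocol_tester h)).trans
      (congrFun (Protocol.result_andThen _ _ _ _ _ _) v)
  exact ((FixedTimeAlgorithm.outputs_iff _ ω v true).trans (accept_tester_iff h _)).trans
    (Eq.congr_left (congrArg (fun x : Node A.State => A.output x.inner) hfinal))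

variable {L : ℕ} {F : RootedForest V L}

theorem RootedForest.isIdAssignment_label [DecidableEq V] (hκ : 1 ≤ κ)
    (hid : Function.Injective ident) (k : ℕ) :
    IsIdAssignment κ fun u : {u | F.center u = k} => F.label ident u := by
  refine ⟨F.injective_label hid k, fun u => ?_⟩
  have hcard : #{v | F.center v = F.center u} = Fintype.card {v | F.center v = k} := by
    rw [show F.center u = k from u.2]
    exact (Fintype.card_subtype _).symm
  exact (F.label_lt ident u).trans_le
    (hcard.trans_le (Nat.le_self_pow (Nat.one_le_iff_ne_zero.1 hκ) _))

theorem DistAlgorithm.Verifies.output_inner_iff [DecidableEq V] (hκ : 1 ≤ κ)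
    (hver : A.Verifies κ P B r) (hid : Function.Injective ident) {start : V → ℕ}
    (hF : IsClustering G ident start F) {w : ℕ} (hw : B * Nat.clog 2 (Fintype.card V) ≤ w)
    {x : V → Node A.State} (hx : Simulates A G ident F 0 x) (v : V) :
    (∀ u, F.center u = F.center v → A.output
      ((simulatePhase A (r * (2 * L + 1))).result w G ident x u).inner = some true) ↔
      P.Holds (G.induce {u | F.center u = F.center v}) := by
  have hverify (v : V) := hver _ _ _ (hF.connected_induce v) (F.isIdAssignment_label hκ hid _)
  have hB (k : ℕ) : A.RespectsBandwidth B (G.induce {u | F.center u = k})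
      fun u => F.label ident u := by
    rintro ω t ⟨u, rfl⟩
    exact (hverify u).1 ω t ⟨u, rfl⟩
  have hsim := hx.run_simulatePhase hid hB hw (r * (2 * L + 1)) (r * (2 * L + 1))
  obtain ⟨-, hhalts, hverdict⟩ := hverify v
  have houtput (u : {u | F.center u = F.center v}) :
      A.Outputs (G.induce {u | F.center u = F.center v}) (fun u => F.label ident u)
        (fun _ _ => false) u true ↔
      A.output ((simulatePhase A (r * (2 * L + 1))).result w G ident x u).inner = some true := by
    have hsome := A.isSome_verdict_of_le (hhalts (fun _ _ => false) u)
      (Nat.mul_le_mul_left r (Nat.succ_le_succ (hF.diam_induce_le v)))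
    rw [DistAlgorithm.outputs_iff hsome]
    exact Eq.congr_left (congrArg A.output (hsim.inner _ u).symm)
  rw [← hverdict fun _ _ => false, Subtype.forall]
  exact forall₂_congr fun u hu => (houtput ⟨u, hu⟩).symm

theorem DistAlgorithm.Verifies.exists_outputs_tester_iff (hκ : 1 ≤ κ)
    (hver : A.Verifies κ P B r) (hid : IsIdAssignment κ ident)
    (h : ¬ EdgelessDecides P ε (Fintype.card V))
    (ω : (tester A P (B + (2 * κ + 2)) r ε k).toAlgorithm.Coins V) :
    ∃ F : RootedForest V (shiftBound k (Fintype.card V) + 1),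
      IsClustering G ident
        (fun v => shiftBound k (Fintype.card V) - shift k (shiftBound k (Fintype.card V)) (ω v)) F ∧
      ∀ v, (∀ u, F.center u = F.center v →
        (tester A P (B + (2 * κ + 2)) r ε k).toAlgorithm.Outputs G ident ω u true) ↔
        P.Holds (G.induce {u | F.center u = F.center v}) := by
  classical
  have hn : 2 ≤ Fintype.card V := not_le.1 fun hn => h (.inl hn)
  have hfits := hid.fits hκ hn (b := B + (2 * κ + 2)) (Nat.le_add_left _ _)
  have hknows : KnowsNeighbors G ident
      ((tester A P (B + (2 * κ + 2)) r ε k).initial G ident ω) := by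
    refine ⟨fun v => rfl, fun v i => mem_image.trans (exists_congr fun u => ?_)⟩
    rw [SimpleGraph.mem_neighborFinset]
  obtain ⟨F, hF, hsim⟩ := hknows.exists_simulates (A := A) hid.1 hfits (fun v => rfl)
    fun v => Nat.lt_succ_of_le (Nat.sub_le _ _)
  refine ⟨F, hF, fun v => ?_⟩
  rw [← hver.output_inner_iff hκ hid.1 hF (Nat.mul_le_mul_right _ (Nat.le_add_right _ (2 * κ + 2)))
    hsim v]
  exact forall₂_congr fun u _ => outputs_tester_iff h ω u

/-! #### Correctness -/

open Classical in
theorem IsClustering.ncard_cut_le {K : ℕ} {y : V → ℕ} (hy : ∀ v, y v ≤ K)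
    (hF : IsClustering G ident (fun v => K - y v) F) :
    (G ⊓ (⊤ : SimpleGraph ℕ).comap F.center).edgeSet.ncard ≤
      #{e ∈ G.edgeFinset | ¬ HasGap (cappedDist G K e.out.1) y} := by
  rw [← Set.ncard_coe_finset]
  refine Set.ncard_le_ncard fun e he => ?_
  have hadj : (G ⊓ (⊤ : SimpleGraph ℕ).comap F.center).Adj e.out.1 e.out.2 := by
    rwa [← SimpleGraph.mem_edgeSet, Sym2.mk, Prod.mk.eta, Quot.out_eq]
  rw [mem_coe, mem_filter, SimpleGraph.mem_edgeFinset]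
  exact ⟨SimpleGraph.edgeSet_mono inf_le_left he, fun hgap =>
    hadj.2 (hF.center_eq_of_hasGap hy hadj.1 hgap)⟩

open Classical in
theorem DistAlgorithm.Verifies.exists_outputs_tester_false [Nonempty V] (hκ : 1 ≤ κ)
    (hver : A.Verifies κ P B r) (hnd : P.NonDisjointed) (hid : IsIdAssignment κ ident)
    (h : ¬ EdgelessDecides P ε (Fintype.card V)) (hfar : P.IsFar ε G)
    (ω : (tester A P (B + (2 * κ + 2)) r ε k).toAlgorithm.Coins V)
    (hshift : ∀ v, shift k (shiftBound k (Fintype.card V)) (ω v) ≤ shiftBound k (Fintype.card V))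
    (hcut : (#{e ∈ G.edgeFinset | ¬ HasGap (cappedDist G (shiftBound k (Fintype.card V)) e.out.1)
      (shift k (shiftBound k (Fintype.card V)) ∘ ω)} : ℝ) < ε * #G.edgeFinset) :
    ∃ v, (tester A P (B + (2 * κ + 2)) r ε k).toAlgorithm.Outputs G ident ω v false := by
  obtain ⟨F, hF, haccept⟩ := hver.exists_outputs_tester_iff (k := k) (G := G) hκ hid h ω
  have hnot : ¬ P.Holds (withinClusters G F.center) := by
    refine hfar.not_holds_withinClusters _ ((Nat.cast_le.2 (hF.ncard_cut_le hshift)).trans_lt ?_)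
    rwa [← SimpleGraph.coe_edgeFinset, Set.ncard_coe_finset]
  obtain ⟨w, hw⟩ := hnd.exists_not_holds_induce F.center hnot
  obtain ⟨v, -, hv⟩ := by simpa only [not_forall] using mt (haccept w).1 hw
  rw [FixedTimeAlgorithm.outputs_iff, Bool.not_eq_true] at hv
  exact ⟨v, (FixedTimeAlgorithm.outputs_iff ..).2 hv⟩

theorem DistAlgorithm.Verifies.outputs_tester_true (hκ : 1 ≤ κ) (hver : A.Verifies κ P B r)
    (hnd : P.NonDisjointed) (hid : IsIdAssignment κ ident) (hG : P.Holds G)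
    (ω : (tester A P (B + (2 * κ + 2)) r ε k).toAlgorithm.Coins V) (v : V) :
    (tester A P (B + (2 * κ + 2)) r ε k).toAlgorithm.Outputs G ident ω v true := by
  by_cases h : EdgelessDecides P ε (Fintype.card V)
  · have : Nonempty V := ⟨v⟩
    rw [FixedTimeAlgorithm.outputs_iff]
    exact (accept_tester_of_edgelessDecides h _).2
      (GraphProperty.holds_bot_fin_iff.2 (hnd.holds_bot hG))
  · obtain ⟨F, -, haccept⟩ := hver.exists_outputs_tester_iff hκ hid h ω
    exact (haccept v).2 (hnd.holds_induce hG ⟨v, rfl⟩) v rfl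

theorem GraphProperty.IsFar.not_holds_bot_fin (hfar : P.IsFar ε G)
    (h : EdgelessDecides P ε (Fintype.card V)) :
    ¬ P.Holds (⊥ : SimpleGraph (Fin (Fintype.card V))) := by
  intro hfin
  have hbot := holds_bot_fin_iff.1 hfin
  rcases h with hn | hε | hnot
  · have := Fintype.card_le_one_iff_subsingleton.1 hn
    exact hfar.1 (Subsingleton.elim (⊥ : SimpleGraph V) G ▸ hbot)
  · exact hε.not_ge (hfar.le_one hbot)
  · exact hnot hfin

theorem DistAlgorithm.Verifies.two_thirds_le_rejectProb_tester [Nonempty V] (hκ : 1 ≤ κ)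
    (hver : A.Verifies κ P B r) (hnd : P.NonDisjointed) (hk : 36 ≤ ε * 2 ^ k)
    (hid : IsIdAssignment κ ident) (hfar : P.IsFar ε G) :
    2 / 3 ≤ (tester A P (B + (2 * κ + 2)) r ε k).toAlgorithm.rejectProb G ident := by
  classical
  by_cases h : EdgelessDecides P ε (Fintype.card V)
  · refine DistAlgorithm.le_rejectProb _ univ ?_ fun ω _ => ⟨Classical.arbitrary V, ?_⟩
    · rw [card_univ]
      exact mul_le_of_le_one_left (Nat.cast_nonneg _) (by norm_num)
    · refine (FixedTimeAlgorithm.outputs_iff _ ω _ false).2 (Bool.eq_false_iff.2 fun haccept => ?_)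
      exact hfar.not_holds_bot_fin h ((accept_tester_of_edgelessDecides h _).1 haccept)
  · have hbot : P.Holds (⊥ : SimpleGraph V) :=
      GraphProperty.holds_bot_fin_iff.1 (not_not.1 fun hnot => h (.inr (.inr hnot)))
    have hE := SimpleGraph.edgeFinset_nonempty.2 (hfar.ne_bot hbot)
    refine DistAlgorithm.le_rejectProb _ _ (two_thirds_le_card_shifts hk rfl
      (isTruncatedGeometric_shift k (shiftBound k (Fintype.card V))) hE
      fun e => cappedDist G (shiftBound k (Fintype.card V)) e.out.1) fun ω hω => ?_
    obtain ⟨hshift, hcut⟩ := (mem_filter_univ ω).1 hω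
    exact hver.exists_outputs_tester_false hκ hnd hid h hfar ω (fun v => (hshift v).le) hcut

theorem DistAlgorithm.Verifies.isOneSidedTester_tester (hκ : 1 ≤ κ) (hver : A.Verifies κ P B r)
    (hnd : P.NonDisjointed) (hε : 0 < ε) (hk : 36 ≤ ε * 2 ^ k) (hk' : ε ≤ 1 → ε * 2 ^ k ≤ 72) :
    IsOneSidedTester κ P ε (B + (2 * κ + 2)) (fun n => 6912 * (r + 1) * Real.log n / ε)
      (tester A P (B + (2 * κ + 2)) r ε k).toAlgorithm where
  bandwidth _ _ _ _ _ := FixedTimeAlgorithm.respectsBandwidth _ rfl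
  rounds _ _ _ _ _ _ := ⟨_, rounds_tester_le_log hε hk' _, FixedTimeAlgorithm.haltsWithin_rounds _⟩
  complete _ _ _ _ hid hG := hver.outputs_tester_true hκ hnd hid hG
  sound _ _ _ _ _ hid hfar := hver.two_thirds_le_rejectProb_tester hκ hnd hk hid hfar

theorem exists_shift_parameter (hε : 0 < ε) :
    ∃ k : ℕ, 36 ≤ ε * 2 ^ k ∧ (ε ≤ 1 → ε * 2 ^ k ≤ 72) := by
  rcases le_or_gt ε 1 with h | h
  · obtain ⟨m, hle, hlt⟩ := exists_nat_pow_near (x := 36 / ε) (y := 2)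
      (by rw [le_div_iff₀ hε]; linarith) one_lt_two
    rw [le_div_iff₀ hε] at hle
    rw [div_lt_iff₀ hε] at hlt
    exact ⟨m + 1, by linarith, fun _ => by rw [pow_succ]; linarith⟩
  · exact ⟨6, by linarith, fun h' => absurd h h'.not_gt⟩

end Tester

theorem mainTheorem1_general (κ : ℕ) (hκ : 1 ≤ κ) (P : GraphProperty) (hnd : P.NonDisjointed)
    (hver : VerifiableInDiameterRounds κ P) :
    ∃ (C : ℝ) (B : ℕ), ∀ ε : ℝ, 0 < ε →
      ∃ A : DistAlgorithm,
        IsOneSidedTester κ P ε B (fun n => C * Real.log n / ε) A := by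
  obtain ⟨A, B, r, hA⟩ : ∃ A B r, DistAlgorithm.Verifies A κ P B r := hver
  refine ⟨6912 * (r + 1), B + (2 * κ + 2), fun ε hε => ?_⟩
  obtain ⟨k, hk, hk'⟩ := exists_shift_parameter hε
  exact ⟨_, hA.isOneSidedTester_tester hκ hnd hε hk hk'⟩

theorem mainTheorem1 (κ : ℕ) (hκ : 1 ≤ κ) (P : GraphProperty)
    (hmono : P.EdgeMonotone) (hnd : P.NonDisjointed)
    (hver : VerifiableInDiameterRounds κ P) :
    ∃ (C : ℝ) (B : ℕ), ∀ ε : ℝ, 0 < ε →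
      ∃ A : DistAlgorithm,
        IsOneSidedTester κ P ε B (fun n => C * Real.log n / ε) A :=
  mainTheorem1_general κ hκ P hnd hver
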